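/- Let $\mathbb F_q$ be a finite field with $q$ elements, $\mathbb R_\infty=\mathbb F_q((1/\theta))$, $\mathbb C_\infty$ the completion of an algebraic closure of $\mathbb R_\infty$, and $n\ge 0$ an integer. Let $\mathbb C_\infty[T,\tau]$ be the ring of non-commutative polynomials with $Ta=aT$, $T\tau=\tau T$, $\tau a=a^q\tau$ for $a\in\mathbb C_\infty$. For $x\in\mathbb C_\infty^n$ write $x^{(k)}$ for $x$ with all coordinates raised to the power $q^k$. A *T-motive* of dimension $n$ and rank $r$ is a left $\mathbb C_\infty[T,\tau]$-module $M$ that is free of rank $n$ over $\mathbb C_\infty[\tau]$, free of rank $r$ over $\mathbb C_\infty[T]$, and satisfies $(T-\theta)^mM\subset\tau M$ for some $m$. For $A\in M_n(\mathbb C_\infty)$ let $M(A)$ be the left $\mathbb C_\infty[T,\tau]$-module with generators $e_*=(e_1,\dots,e_n)^t$ and defining relations $Te_*=\theta e_*+A\tau e_*+\tau^2e_*$. Put $\mathrm{Lie}(M)=\mathrm{Hom}_{\mathbb C_\infty}(M/\tau M,\mathbb C_\infty)$ and $E(M)=\mathrm{Hom}_{\mathbb C_\infty[\tau]}(M,\mathbb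 C_\infty)$, where $\tau$ acts on $\mathbb C_\infty$ by $x\mapsto x^q$; $T$ acts on both through $M$. For $M=M(A)$ evaluation at $e_1,\dots,e_n$ identifies both with $\mathbb C_\infty^n$. The exponential of $M(A)$ is the map $\mathrm{Exp}:\mathrm{Lie}(M(A))\to E(M(A))$ that commutes with $T$ and is given in these coordinates by an everywhere convergent series $\mathrm{Exp}(z)=\sum_{k\ge0}C_kz^{(k)}$, $C_k\in M_n(\mathbb C_\infty)$, $C_0=E_n$. The lattice of $M(A)$ is $L(M(A))=\ker\mathrm{Exp}\subset\mathbb C_\infty^n$. A *lattice* of rank $r$ in $\mathbb C_\infty^n$ is a free $\mathbb F_q[\theta]$-submodule of rank $r$ that spans $\mathbb C_\infty^n$ over $\mathbb C_\infty$ and whose $\mathbb R_\infty$-span has dimension $r$ over $\mathbb R_\infty$. If $l_1,\dots,l_{2n}$ is an $\mathbb F_q[\theta]$-basis of a lattice of rank $2n$ and $l_1,\dots,l_n$ is a $\mathbb C_\infty$-basis of $\mathbb C_\infty^n$, its *Siegel matrix* is the matrix $Z=(z_{ij})\in M_n(\mathbb C_\infty)$ with $l_{n+i}=\sum_jz_{ij}l_j$.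 Let $S_3\subset M_n(\mathbb C_\infty)$ be the set of all Siegel matrices so obtained, and for $Z\in M_n(\mathbb C_\infty)$ let $\mathfrak L(Z)$ be the $\mathbb F_q[\theta]$-span of the standard basis vectors and the rows of $Z$. Fix $\omega\in\mathbb F_{q^2}\setminus\mathbb F_q$, let $L_0=\mathfrak L(\omega E_n)$, let $l_{0,i}$ be the $i$-th standard basis vector and $l_{0,n+i}=\omega l_{0,i}$ ($1\le i\le n$). **Proposition 2.2.** Every $M(A)$ is a T-motive of dimension $n$ and rank $2n$. There is $y\in\mathbb C_\infty^*$ with $y^{-1}L(M(0))=L_0$. For every such $y$ there are open neighbourhoods $\mathfrak U_1\subset M_n(\mathbb C_\infty)$ of $0$ and $\mathfrak U_3\subset S_3$ of $\omega E_n$ (open in $M_n(\mathbb C_\infty)$) and a map $\mu_{13}:\mathfrak U_1\to\mathfrak U_3$ such that: 1. (Commutativity of the diagram of matrices, T-motives, Siegel matrices and lattices.) For every $A\in\mathfrak U_1$, $L(M(A))$ is a lattice of rank $2n$, and it equals $\mathfrak L(\mu_{13}(A))$ up to a $\mathbb C_\infty$-linear automorphism of $\mathbb C_\infty^n$. 2.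 For every $A\in\mathfrak U_1$ the lattice $y^{-1}L(M(A))$ has an $\mathbb F_q[\theta]$-basis $l_1(A),\dots,l_{2n}(A)$ such that $l_1(A),\dots,l_n(A)$ is a $\mathbb C_\infty$-basis of $\mathbb C_\infty^n$ and the Siegel matrix of this basis is $\mu_{13}(A)$. This basis is the one close to the basis $l_{0,1},\dots,l_{0,2n}$ of $L_0$: there is $\rho>0$, independent of $A$, such that for all $A\in\mathfrak U_1$ and all $i$ the vector $l_i(A)$ is the only element of $y^{-1}L(M(A))$ at distance less than $\rho$ from $l_{0,i}$; and $l_i(A)\to l_{0,i}$ as $A\to0$. -/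

import Mathlib

open Filter Topology

noncomputable section

/-! ## The field `C∞` -/

/-- The local field `F((1/θ))`, realised as Laurent series in the variable `1/θ`. -/
abbrev RInf (F : Type*) [Field F] : Type _ := LaurentSeries F

/-- The valuation of `F((1/θ))` as a real absolute value, normalised by `|θ| = #F`. -/
instance RInf.rankOne (F : Type*) [Field F] [Fintype F] :
    (Valued.v : Valuation (RInf F) (WithZero (Multiplicative ℤ))).RankOne where
  hom' := (WithZeroMulInt.toNNReal (e := (Fintype.card F : NNReal))
      (by simp [Fintype.card_ne_zero])).comp MonoidWithZeroHom.ValueGroup₀.embedding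
  strictMono' := (WithZeroMulInt.toNNReal_strictMono
      (by exact_mod_cast Fintype.one_lt_card)).comp
        MonoidWithZeroHom.ValueGroup₀.embedding_strictMono
  exists_val_nontrivial := by
    refine ⟨HahnSeries.single 1 1, ?_, ?_⟩
    · have h := LaurentSeries.valuation_single_zpow F 1
      rw [h]; simp
    · have h := LaurentSeries.valuation_single_zpow F 1
      rw [h]
      intro h1
      have h2 : WithZero.log (WithZero.exp (-1 : ℤ)) = WithZero.log 1 := by rw [h1]
      simp at h2

instance RInf.nontriviallyNormedField (F : Type*) [Field F] [Fintype F] :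
    NontriviallyNormedField (RInf F) :=
  Valued.toNontriviallyNormedField (RInf F) (WithZero (Multiplicative ℤ))

instance RInf.isUltrametricDist (F : Type*) [Field F] [Fintype F] :
    IsUltrametricDist (RInf F) :=
  IsUltrametricDist.isUltrametricDist_of_forall_norm_add_le_max_norm
    (Valued.isNonarchimedean_norm (RInf F) (WithZero (Multiplicative ℤ)))

/-- The algebraic closure of `F((1/θ))`. -/
def RInfAlgCl (F : Type*) [Field F] : Type _ := AlgebraicClosure (RInf F)

instance RInfAlgCl.field (F : Type*) [Field F] : Field (RInfAlgCl F) :=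
  inferInstanceAs (Field (AlgebraicClosure (RInf F)))

instance RInfAlgCl.algebra (F : Type*) [Field F] : Algebra (RInf F) (RInfAlgCl F) :=
  inferInstanceAs (Algebra (RInf F) (AlgebraicClosure (RInf F)))

instance RInfAlgCl.isAlgClosure (F : Type*) [Field F] : IsAlgClosure (RInf F) (RInfAlgCl F) :=
  inferInstanceAs (IsAlgClosure (RInf F) (AlgebraicClosure (RInf F)))

instance RInfAlgCl.isAlgebraic (F : Type*) [Field F] :
    Algebra.IsAlgebraic (RInf F) (RInfAlgCl F) :=
  IsAlgClosure.isAlgebraic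

/-- The unique extension of the absolute value of `F((1/θ))` to its algebraic closure. -/
instance RInfAlgCl.normedField (F : Type*) [Field F] [Fintype F] : NormedField (RInfAlgCl F) :=
  spectralNorm.normedField (RInf F) (RInfAlgCl F)

instance RInfAlgCl.normedAlgebra (F : Type*) [Field F] [Fintype F] :
    NormedAlgebra (RInf F) (RInfAlgCl F) :=
  spectralNorm.normedAlgebra (RInf F) (RInfAlgCl F)

/-- `C∞`, the completion of the algebraic closure of `F((1/θ))`. -/
def CInf (F : Type*) [Field F] [Fintype F] : Type _ := UniformSpace.Completion (RInfAlgCl F)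

section CInf

variable (F : Type*) [Field F] [Fintype F]

instance CInf.normedField : NormedField (CInf F) :=
  inferInstanceAs (NormedField (UniformSpace.Completion (RInfAlgCl F)))

instance CInf.completeSpace : CompleteSpace (CInf F) :=
  inferInstanceAs (CompleteSpace (UniformSpace.Completion (RInfAlgCl F)))

instance CInf.normedAlgebra : NormedAlgebra (RInf F) (CInf F) :=
  inferInstanceAs (NormedAlgebra (RInf F) (UniformSpace.Completion (RInfAlgCl F)))

instance CInf.algebra : Algebra F (CInf F) :=
  ((algebraMap (RInf F) (CInf F)).comp (HahnSeries.C : F →+* RInf F)).toAlgebra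

/-- The element `θ` of `C∞`. -/
def CInf.theta : CInf F := algebraMap (RInf F) (CInf F) (HahnSeries.single (-1) 1)

/-- The ring `F[θ]`, as a subring of `C∞`. -/
abbrev ZInf : Subalgebra F (CInf F) := Algebra.adjoin F {CInf.theta F}

/-- The `q`-Frobenius action on `C∞`, `q = #F`: the generator of `ℕ` acts by `x ↦ x ^ q`. -/
instance CInf.frobeniusAction : MulSemiringAction (Multiplicative ℕ) (CInf F) where
  smul k x := x ^ (Fintype.card F ^ k.toAdd)
  one_smul x := by
    change x ^ (Fintype.card F ^ 0) = x
    simp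
  mul_smul j k x := by
    change x ^ (Fintype.card F ^ (j.toAdd + k.toAdd))
      = (x ^ (Fintype.card F ^ k.toAdd)) ^ (Fintype.card F ^ j.toAdd)
    rw [← pow_mul, ← pow_add, add_comm]
  smul_zero k := by
    change (0 : CInf F) ^ (Fintype.card F ^ k.toAdd) = 0
    exact zero_pow (pow_ne_zero _ Fintype.card_ne_zero)
  smul_one k := one_pow _
  smul_add k x y := by
    change (x + y) ^ (Fintype.card F ^ k.toAdd)
      = x ^ (Fintype.card F ^ k.toAdd) + y ^ (Fintype.card F ^ k.toAdd)
    have h := map_add ((FiniteField.frobeniusAlgHom F (CInf F)) ^ k.toAdd) x y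
    simpa [AlgHom.coe_pow, FiniteField.coe_frobeniusAlgHom, pow_iterate] using h
  smul_mul k x y := mul_pow _ _ _

/-! ## T-motives -/

/-- The Anderson ring `C∞[T, τ]`: skew polynomials in `τ` over `C∞[T]`, where `τ` acts on the
coefficients in `C∞` as the `q`-Frobenius and fixes `T`. -/
def AndersonRing : Type _ := SkewPolynomial (Polynomial (CInf F))

instance AndersonRing.ring : Ring (AndersonRing F) :=
  inferInstanceAs (Ring (SkewPolynomial (Polynomial (CInf F))))

/-- The inclusion of `C∞` into the Anderson ring. -/
def AndersonRing.const : CInf F →+* AndersonRing F :=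
  (SkewPolynomial.CRingHom (R := Polynomial (CInf F))).comp Polynomial.C

/-- The element `T` of the Anderson ring. -/
def AndersonRing.T : AndersonRing F := SkewPolynomial.C (Polynomial.X : Polynomial (CInf F))

/-- The element `τ` of the Anderson ring. -/
def AndersonRing.tau : AndersonRing F := SkewPolynomial.X (R := Polynomial (CInf F))

theorem AndersonRing.T_mul_const (a : CInf F) :
    T F * const F a = const F a * T F := by
  have h : (SkewPolynomial.C Polynomial.X : SkewPolynomial (Polynomial (CInf F)))
      * SkewPolynomial.C (Polynomial.C a)
      = SkewPolynomial.C (Polynomial.C a) * SkewPolynomial.C Polynomial.X := by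
    rw [← SkewPolynomial.C_mul, ← SkewPolynomial.C_mul, mul_comm]
  exact h

theorem AndersonRing.T_mul_tau : T F * tau F = tau F * T F := by
  have h : (SkewPolynomial.C Polynomial.X : SkewPolynomial (Polynomial (CInf F)))
      * SkewPolynomial.X = SkewPolynomial.X * SkewPolynomial.C Polynomial.X := by
    simp only [SkewPolynomial.X, SkewPolynomial.C_mul_monomial, SkewPolynomial.monomial_mul_C]
    simp [SkewPolynomial.φ]
  exact h

theorem AndersonRing.tau_mul_const (a : CInf F) :
    tau F * const F a = const F (a ^ Fintype.card F) * tau F := by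
  have ha : (Multiplicative.ofAdd 1 : Multiplicative ℕ) • a = a ^ Fintype.card F := by
    change a ^ (Fintype.card F ^ 1) = _
    simp
  have h : (SkewPolynomial.X : SkewPolynomial (Polynomial (CInf F)))
      * SkewPolynomial.C (Polynomial.C a)
      = SkewPolynomial.C (Polynomial.C (a ^ Fintype.card F)) * SkewPolynomial.X := by
    simp only [SkewPolynomial.X, SkewPolynomial.C_mul_monomial, SkewPolynomial.monomial_mul_C]
    simp [SkewPolynomial.φ, Polynomial.smul_C, ha]
  exact h

/-- The subring `C∞[T]` of the Anderson ring. -/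
def AndersonRing.polyT : Subring (AndersonRing F) :=
  Subring.closure (Set.range (const F) ∪ {T F})

/-- The subring `C∞[τ]` of the Anderson ring. -/
def AndersonRing.polyTau : Subring (AndersonRing F) :=
  Subring.closure (Set.range (const F) ∪ {tau F})

/-- The left module `M` over the Anderson ring is a T-motive of dimension `n` and rank `r`. -/
structure IsTMotive (n r : ℕ) (M : Type*) [AddCommGroup M] [Module (AndersonRing F) M] :
    Prop where
  free_tau : Nonempty (Module.Basis (Fin n) (AndersonRing.polyTau F) M)
  free_T : Nonempty (Module.Basis (Fin r) (AndersonRing.polyT F) M)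
  /-- some power of `T - θ` annihilates `M / τM` -/
  nilpotent : ∃ m : ℕ, ∀ x : M, ∃ y : M,
    (AndersonRing.T F - AndersonRing.const F (CInf.theta F)) ^ m • x = AndersonRing.tau F • y

variable {F}

/-- The relation `T eᵢ - (θ eᵢ + ∑ⱼ Aᵢⱼ τ eⱼ + τ² eᵢ)` in the free module on `e₁, …, eₙ`. -/
def motiveRelation {n : ℕ} (A : Matrix (Fin n) (Fin n) (CInf F)) (i : Fin n) :
    Fin n → AndersonRing F :=
  Pi.single i (AndersonRing.T F)
    - (Pi.single i (AndersonRing.const F (CInf.theta F))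
      + ∑ j, Pi.single j (AndersonRing.const F (A i j) * AndersonRing.tau F)
      + Pi.single i (AndersonRing.tau F ^ 2))

/-- `M(A)`: the module over the Anderson ring with generators `e₁, …, eₙ` (the column `e`) and
the defining relations `T e = θ e + A τ e + τ² e`. -/
abbrev Motive {n : ℕ} (A : Matrix (Fin n) (Fin n) (CInf F)) : Type _ :=
  (Fin n → AndersonRing F) ⧸
    Submodule.span (AndersonRing F) (Set.range (motiveRelation A))

/-- The generators `e₁, …, eₙ` of `M(A)`. -/
def Motive.e {n : ℕ} (A : Matrix (Fin n) (Fin n) (CInf F)) (i : Fin n) : Motive A :=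
  Submodule.Quotient.mk (Pi.single i 1)

/-! ## The lattice of a T-motive -/

section Exponential

variable (F) (M : Type*) [AddCommGroup M] [Module (AndersonRing F) M]

/-- `E(M) = Hom_{C∞[τ]}(M, C∞)`, where `τ` acts on `C∞` as the `q`-Frobenius: the `C∞`-points of
the Anderson T-module of `M`. -/
def TPoints : AddSubgroup (M →+ CInf F) where
  carrier := {f | (∀ a m, f (AndersonRing.const F a • m) = a * f m) ∧
    ∀ m, f (AndersonRing.tau F • m) = f m ^ Fintype.card F}
  zero_mem' := ⟨by simp, by simp⟩
  add_mem' {f g} hf hg := by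
    refine ⟨fun a m => ?_, fun m => ?_⟩
    · simp [hf.1, hg.1, mul_add]
    · have h := map_add (FiniteField.frobeniusAlgHom F (CInf F)) (f m) (g m)
      simp only [FiniteField.coe_frobeniusAlgHom] at h
      simp [hf.2, hg.2, h]
  neg_mem' {f} hf := by
    refine ⟨fun a m => ?_, fun m => ?_⟩
    · simp [hf.1]
    · have h := map_neg (FiniteField.frobeniusAlgHom F (CInf F)) (f m)
      simp only [FiniteField.coe_frobeniusAlgHom] at h
      simp [hf.2, h]

/-- `Lie(M) = Hom_{C∞}(M / τM, C∞)`, the tangent space at `0` of the T-module `E(M)`. -/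
def TLie : Submodule (CInf F) (M →+ CInf F) where
  carrier := {f | (∀ a m, f (AndersonRing.const F a • m) = a * f m) ∧
    ∀ m, f (AndersonRing.tau F • m) = 0}
  zero_mem' := ⟨by simp, by simp⟩
  add_mem' {f g} hf hg :=
    ⟨fun a m => by simp [hf.1, hg.1, mul_add], fun m => by simp [hf.2, hg.2]⟩
  smul_mem' c f hf :=
    ⟨fun a m => by simp [hf.1, mul_left_comm], fun m => by simp [hf.2]⟩

variable {F} {M}

/-- The action of `T` on `E(M)`: `(T f)(m) = f (T m)`. -/
def TPoints.T (f : TPoints F M) : TPoints F M :=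
  ⟨(f : M →+ CInf F).comp (DistribSMul.toAddMonoidHom M (AndersonRing.T F)), by
    refine ⟨fun a m => ?_, fun m => ?_⟩
    · change f.1 (AndersonRing.T F • AndersonRing.const F a • m) = a * f.1 (AndersonRing.T F • m)
      rw [← mul_smul, AndersonRing.T_mul_const, mul_smul, f.2.1]
    · change f.1 (AndersonRing.T F • AndersonRing.tau F • m) = f.1 (AndersonRing.T F • m) ^ Fintype.card F
      rw [← mul_smul, AndersonRing.T_mul_tau, mul_smul, f.2.2]⟩

/-- The action of `T` on `Lie(M)`: `(T f)(m) = f (T m)`. -/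
def TLie.T (f : TLie F M) : TLie F M :=
  ⟨(f : M →+ CInf F).comp (DistribSMul.toAddMonoidHom M (AndersonRing.T F)), by
    refine ⟨fun a m => ?_, fun m => ?_⟩
    · change f.1 (AndersonRing.T F • AndersonRing.const F a • m) = a * f.1 (AndersonRing.T F • m)
      rw [← mul_smul, AndersonRing.T_mul_const, mul_smul, f.2.1]
    · change f.1 (AndersonRing.T F • AndersonRing.tau F • m) = 0
      rw [← mul_smul, AndersonRing.T_mul_tau, mul_smul, f.2.2]⟩

/-- `Exp : Lie(M) → E(M)` is the exponential map of `M`: it commutes with `T` and, in the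
coordinates `z ↦ (z(e₁), …, z(eₙ))` on `Lie(M)` and `E(M)` given by a `C∞[τ]`-basis `e` of `M`, it
is an everywhere convergent series `z ↦ ∑ₖ Cₖ z^(k)` with `C₀ = 1`, where `z^(k)` is `z` with all
coordinates raised to the power `q ^ k`. -/
structure IsExponential {n : ℕ} (e : Fin n → M) (Exp : TLie F M → TPoints F M) : Prop where
  series : ∃ C : ℕ → Matrix (Fin n) (Fin n) (CInf F), C 0 = 1 ∧ ∀ (z : TLie F M) (i : Fin n),
    HasSum (fun k : ℕ => ∑ j, C k i j * (z : M →+ CInf F) (e j) ^ (Fintype.card F ^ k))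
      ((Exp z : M →+ CInf F) (e i))
  equivariant : ∀ z : TLie F M, Exp (TLie.T z) = TPoints.T (Exp z)

/-- The lattice of `M`, that is the kernel of the exponential map of `M`, in the coordinates on
`Lie(M)` given by a `C∞[τ]`-basis `e` of `M`. -/
def tLattice {n : ℕ} (e : Fin n → M) : Set (Fin n → CInf F) :=
  {v | ∃ Exp : TLie F M → TPoints F M, IsExponential e Exp ∧
    ∃ z : TLie F M, (∀ i, (z : M →+ CInf F) (e i) = v i) ∧ Exp z = 0}

end Exponential

/-- The lattice of `M(A)`, in the coordinates given by the generators `e₁, …, eₙ`. -/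
def motiveLattice {n : ℕ} (A : Matrix (Fin n) (Fin n) (CInf F)) : Set (Fin n → CInf F) :=
  tLattice (Motive.e A)

/-! ## Lattices and Siegel matrices -/

/-- The vectors `b` form an `F[θ]`-basis of `L`. -/
def IsZBasis {n : ℕ} {ι : Type*} (b : ι → Fin n → CInf F) (L : Set (Fin n → CInf F)) : Prop :=
  LinearIndependent (ZInf F) b ∧
    (Submodule.span (ZInf F) (Set.range b) : Set (Fin n → CInf F)) = L

/-- `L` is a lattice of rank `r` in `C∞ⁿ`: a free `F[θ]`-submodule of rank `r` which generates
`C∞ⁿ` over `C∞` and whose `F((1/θ))`-linear envelope has dimension `r` over `F((1/θ))`. -/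
structure IsLattice {n : ℕ} (r : ℕ) (L : Set (Fin n → CInf F)) : Prop where
  free : ∃ b : Fin r → Fin n → CInf F, IsZBasis b L
  span_eq_top : Submodule.span (CInf F) L = ⊤
  finrank_envelope : Module.finrank (RInf F) (Submodule.span (RInf F) L) = r

/-- Two lattices agree up to a `C∞`-linear automorphism of the ambient space. -/
def LatticeEquiv {n : ℕ} (L L' : Set (Fin n → CInf F)) : Prop :=
  ∃ g : (Fin n → CInf F) ≃ₗ[CInf F] (Fin n → CInf F), g '' L = L'

/-- `Z` is the Siegel matrix of the family `b` (with `b (inl i)` the first `n` vectors and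
`b (inr i)` the last `n`): the first `n` vectors are a `C∞`-basis of `C∞ⁿ`, and the rows of `Z`
are the coordinates of the last `n` vectors in that basis. -/
def IsSiegelMatrixOf {n : ℕ} (b : Fin n ⊕ Fin n → Fin n → CInf F)
    (Z : Matrix (Fin n) (Fin n) (CInf F)) : Prop :=
  LinearIndependent (CInf F) (fun i => b (Sum.inl i)) ∧
    Submodule.span (CInf F) (Set.range fun i => b (Sum.inl i)) = ⊤ ∧
    ∀ i, b (Sum.inr i) = ∑ j, Z i j • b (Sum.inl j)

/-- The set of `n × n` Siegel matrices, i.e. of Siegel matrices of bases of lattices of rank `2n`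
in `C∞ⁿ`. -/
def siegelMatrices (F : Type*) [Field F] [Fintype F] (n : ℕ) :
    Set (Matrix (Fin n) (Fin n) (CInf F)) :=
  {Z | ∃ (L : Set (Fin n → CInf F)) (b : Fin n ⊕ Fin n → Fin n → CInf F),
    IsLattice (2 * n) L ∧ IsZBasis b L ∧ IsSiegelMatrixOf b Z}

/-- The standard basis vectors of `C∞ⁿ`, followed by the rows of `Z`. -/
def siegelBasis {n : ℕ} (Z : Matrix (Fin n) (Fin n) (CInf F)) :
    Fin n ⊕ Fin n → Fin n → CInf F :=
  Sum.elim (fun i => Pi.single i 1) (fun i => Z i)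

/-- The lattice `𝔏(Z)` corresponding to the Siegel matrix `Z`. -/
def siegelLattice {n : ℕ} (Z : Matrix (Fin n) (Fin n) (CInf F)) : Set (Fin n → CInf F) :=
  Submodule.span (ZInf F) (Set.range (siegelBasis Z))

/-- The lattice of `M(A)` in the coordinates of `C∞ⁿ` rescaled by `y`. -/
def scaledMotiveLattice {n : ℕ} (y : CInf F) (A : Matrix (Fin n) (Fin n) (CInf F)) :
    Set (Fin n → CInf F) :=
  {v | y • v ∈ motiveLattice A}

/-- Rescaling by the number `y ≠ 0` identifies the lattice of `M(0)` with `L₀ = 𝔏(ω Eₙ)`. -/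
def IsNormalization (n : ℕ) (ω y : CInf F) : Prop :=
  y ≠ 0 ∧ scaledMotiveLattice y (0 : Matrix (Fin n) (Fin n) (CInf F))
    = siegelLattice (ω • (1 : Matrix (Fin n) (Fin n) (CInf F)))

end CInf

end

/-!
Families of linear forms on `C∞[T, τ]` that are compatible with the relations of `M(A)` descend to
`M(A)`; they show that the obvious generators are bases and identify `Lie` and `E` with `C∞ⁿ`.

For `‖A‖ ≤ 1` the equation `Exp (θ z) = T (Exp z)` determines the coefficients of the exponential
recursively and bounds them so well that `Exp` is an isometric bijection on the open ball whose
radius `R = q · q ^ (1 / (q² - 1))` is the norm of the shortest possible period; moreover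
`‖Exp_A z - Exp_B z‖ ≤ ‖A - B‖ ‖z‖` for `‖z‖ ≤ R`. The periods of `M(0)` are `𝔽_q[θ]`-combinations
of `y ζ`, with `ζ` having coordinates in `𝔽_{q²}` and `‖y‖ = R`. For small `A` each of them can be
corrected to a nearby period of `M(A)`. Since `Exp_A` shrinks no vector of norm less than `R`,
nearby periods are unique, and since being orthogonal for the ultrametric norm over `𝔽_q((1/θ))`
survives perturbations smaller than `R`, the corrected periods are again a basis of the lattice
whose Siegel matrix is close to `ω Eₙ`.
-/

noncomputable section

open scoped Matrix Matrix.Norms.Elementwise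

variable {F : Type*} [Field F] [Fintype F]

local notation "q" => Fintype.card F

/-! ### Frobenius and the norm on `C∞` -/

theorem add_pow_card_pow {R : Type*} [CommRing R] [Algebra F R] (x y : R) (k : ℕ) :
    (x + y) ^ q ^ k = x ^ q ^ k + y ^ q ^ k := by
  simpa only [AlgHom.coe_pow, FiniteField.coe_frobeniusAlgHom, pow_iterate] using
    map_add (FiniteField.frobeniusAlgHom F R ^ k) x y

theorem mem_range_algebraMap_of_pow_card_eq {K : Type*} [Field K] [Algebra F K] {a : K}
    (ha : a ^ q = a) : a ∈ (algebraMap F K).range := by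
  have hsplits : (Polynomial.X ^ q - Polynomial.X : Polynomial F).Splits := by
    rw [Polynomial.splits_iff_card_roots, FiniteField.roots_X_pow_card_sub_X,
      FiniteField.X_pow_card_sub_X_natDegree_eq F Fintype.one_lt_card]
    exact Finset.card_univ
  refine hsplits.mem_range_of_isRoot
    (FiniteField.X_pow_card_sub_X_ne_zero F Fintype.one_lt_card) ?_
  simp [ha]

namespace CInf

instance isUltrametricDist : IsUltrametricDist (CInf F) :=
  IsUltrametricDist.of_normedAlgebra (RInf F)

theorem algebraMap_eq (c : F) :
    algebraMap F (CInf F) c = algebraMap (RInf F) (CInf F) (HahnSeries.C c) := rfl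

theorem norm_theta : ‖theta F‖ = q := by
  have h : Valued.v (HahnSeries.single (-1) 1 : RInf F) = WithZero.exp 1 :=
    LaurentSeries.valuation_single_zpow F (-1)
  rw [theta, norm_algebraMap', Valued.toNormedField.norm_def]
  change ((WithZeroMulInt.toNNReal (e := (q : NNReal)) (by simp)
    (MonoidWithZeroHom.ValueGroup₀.embedding _) : NNReal) : ℝ) = _
  rw [Valuation.embedding_restrict, h, WithZeroMulInt.toNNReal_neg_apply _ WithZero.exp_ne_zero]
  change (((q : NNReal) ^ (1 : ℤ) : NNReal) : ℝ) = _
  simp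

theorem theta_ne_zero : theta F ≠ 0 :=
  norm_ne_zero_iff.1 (by rw [norm_theta]; exact_mod_cast Fintype.card_ne_zero)

/-- The `q ^ k`-Frobenius of `C∞`. -/
def frob (k : ℕ) : CInf F →+* CInf F where
  toFun x := x ^ q ^ k
  map_one' := one_pow _
  map_mul' _ _ := mul_pow _ _ _
  map_zero' := zero_pow (pow_ne_zero _ Fintype.card_ne_zero)
  map_add' x y := add_pow_card_pow x y k

theorem frob_apply (k : ℕ) (x : CInf F) : frob k x = x ^ q ^ k := rfl

instance : IsAlgClosed (RInfAlgCl F) := IsAlgClosure.isAlgClosed (RInf F)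

variable (F) in
/-- The embedding of the algebraic closure of `F((1/θ))` into its completion `C∞`. -/
def ofAlgCl : RInfAlgCl F →+* CInf F := UniformSpace.Completion.coeRingHom

theorem exists_pow_eq_neg_theta : ∃ x : CInf F, x ^ (q ^ 2 - 1) = -theta F := by
  have hq : 1 < q ^ 2 := Nat.one_lt_pow two_ne_zero Fintype.one_lt_card
  obtain ⟨z, hz⟩ := IsAlgClosed.exists_pow_nat_eq
    (-algebraMap (RInf F) (RInfAlgCl F) (HahnSeries.single (-1) 1)) (Nat.sub_pos_of_lt hq)
  exact ⟨ofAlgCl F z, by rw [← map_pow, hz, map_neg]; rfl⟩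

theorem isUniformInducing_frob (k : ℕ) : IsUniformInducing (frob (F := F) k) := by
  refine Metric.isUniformInducing_iff.2
    ⟨uniformContinuous_addMonoidHom_of_continuous (continuous_pow (q ^ k)), fun δ hδ =>
      ⟨δ ^ q ^ k, by positivity, fun {x y} hxy => ?_⟩⟩
  rw [dist_eq_norm, ← map_sub, frob_apply, norm_pow, ← dist_eq_norm] at hxy
  exact lt_of_pow_lt_pow_left₀ _ hδ.le hxy

theorem frob_surjective (k : ℕ) : Function.Surjective (frob (F := F) k) := by
  -- The range is closed, being complete, and it contains the algebraic closure of `F((1/θ))`.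
  have hclosed : IsClosed (Set.range (frob (F := F) k)) :=
    (isUniformInducing_frob k).isComplete_range.isClosed
  have hdense : DenseRange (ofAlgCl F) := UniformSpace.Completion.denseRange_coe
  refine Set.range_eq_univ.1 (hclosed.closure_eq ▸ (hdense.mono ?_).closure_eq)
  rintro _ ⟨z, rfl⟩
  obtain ⟨w, hw⟩ := IsAlgClosed.exists_pow_nat_eq z (n := q ^ k) (pow_pos Fintype.card_pos k)
  exact ⟨ofAlgCl F w, by rw [frob_apply, ← map_pow, hw]⟩

end CInf

theorem RInf.exists_norm_sub_C_lt_one {a : RInf F} (ha : ‖a‖ ≤ 1) :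
    ∃ c : F, ‖a - HahnSeries.C c‖ < 1 := by
  rw [Valued.toNormedField.norm_le_one_iff] at ha
  refine ⟨a.coeff 0, Valued.toNormedField.norm_lt_one_iff.2 (lt_of_le_of_lt
    (b := WithZero.exp (-1 : ℤ)) ?_ (WithZero.exp_lt_exp.2 neg_one_lt_zero))⟩
  rw [LaurentSeries.valuation_le_iff_coeff_lt_eq_zero]
  intro m hm
  rcases (Int.lt_add_one_iff.1 (by simpa using hm) : m ≤ 0).lt_or_eq with h | rfl
  · have := (LaurentSeries.valuation_le_iff_coeff_lt_eq_zero F (D := 0)).1 (by simpa using ha) m h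
    simp [this, HahnSeries.C_apply, h.ne]
  · simp

/-- `ω` lies in `F_{q²}` but not in `F_q`. -/
structure IsQuadraticGenerator (ω : CInf F) : Prop where
  pow_card_sq : ω ^ q ^ 2 = ω
  pow_card_ne : ω ^ q ≠ ω

namespace IsQuadraticGenerator

variable {ω : CInf F} (hω : IsQuadraticGenerator ω)
include hω

theorem norm_eq_one : ‖ω‖ = 1 := by
  have h0 : ω ≠ 0 := by
    rintro rfl
    exact hω.pow_card_ne (zero_pow Fintype.card_ne_zero)
  have hq : 1 < q ^ 2 := Nat.one_lt_pow two_ne_zero Fintype.one_lt_card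
  refine (isOfFinOrder_iff_pow_eq_one.2 ⟨q ^ 2 - 1, Nat.sub_pos_of_lt hq, ?_⟩).norm_eq_one
  exact mul_right_cancel₀ h0 (by rw [← pow_succ, Nat.sub_add_cancel hq.le, hω.pow_card_sq, one_mul])

theorem algebraMap_add (c : F) : IsQuadraticGenerator (algebraMap F (CInf F) c + ω) where
  pow_card_sq := by
    rw [add_pow_card_pow, ← map_pow, FiniteField.pow_card_pow, hω.pow_card_sq]
  pow_card_ne h := by
    have hadd := add_pow_card_pow (F := F) (algebraMap F (CInf F) c) ω 1
    rw [pow_one, h, ← map_pow, FiniteField.pow_card] at hadd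
    exact hω.pow_card_ne (add_left_cancel hadd).symm

theorem norm_add_eq_one {a : RInf F} (ha : ‖a‖ ≤ 1) : ‖algebraMap (RInf F) (CInf F) a + ω‖ = 1 := by
  obtain ⟨c, hc⟩ := RInf.exists_norm_sub_C_lt_one ha
  have hsplit : algebraMap (RInf F) (CInf F) a + ω
      = algebraMap (RInf F) (CInf F) (a - HahnSeries.C c) + (algebraMap F (CInf F) c + ω) := by
    rw [map_sub, CInf.algebraMap_eq]
    ring
  rw [← norm_algebraMap' (CInf F), ← (hω.algebraMap_add c).norm_eq_one] at hc
  rw [hsplit, IsUltrametricDist.norm_add_eq_max_of_norm_ne_norm hc.ne, max_eq_right hc.le,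
    (hω.algebraMap_add c).norm_eq_one]

theorem norm_add_mul (a b : RInf F) :
    ‖algebraMap (RInf F) (CInf F) a + algebraMap (RInf F) (CInf F) b * ω‖ = max ‖a‖ ‖b‖ := by
  have hbω : ‖algebraMap (RInf F) (CInf F) b * ω‖ = ‖b‖ := by
    rw [norm_mul, hω.norm_eq_one, norm_algebraMap', mul_one]
  rcases lt_or_ge ‖b‖ ‖a‖ with hlt | hle
  · rw [IsUltrametricDist.norm_add_eq_max_of_norm_ne_norm, hbω, norm_algebraMap']
    rw [hbω, norm_algebraMap']
    exact hlt.ne'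
  · rcases eq_or_ne b 0 with rfl | hb
    · simp_all
    · have hb' : algebraMap (RInf F) (CInf F) b ≠ 0 := (map_ne_zero _).2 hb
      have hfactor : algebraMap (RInf F) (CInf F) a + algebraMap _ _ b * ω
          = algebraMap _ _ b * (algebraMap _ _ (a / b) + ω) := by
        rw [map_div₀]
        field_simp
      rw [hfactor, norm_mul, norm_algebraMap', hω.norm_add_eq_one, max_eq_right hle, mul_one]
      rw [norm_div]
      exact div_le_one_of_le₀ hle (norm_nonneg _)

theorem exists_eq_add_mul {x : CInf F} (hx : x ^ q ^ 2 = x) :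
    ∃ a b : F, x = algebraMap F (CInf F) a + algebraMap F (CInf F) b * ω := by
  have hfrob {z : CInf F} : CInf.frob 1 z = z ^ q := by rw [CInf.frob_apply, pow_one]
  have hfrob_sq {z : CInf F} (hz : z ^ q ^ 2 = z) : CInf.frob 1 (z ^ q) = z := by
    rw [hfrob, ← pow_mul, ← sq, hz]
  have hne : ω ^ q - ω ≠ 0 := sub_ne_zero.2 hω.pow_card_ne
  -- Applying the Frobenius to `x = a + b ω` gives `x ^ q - x = b (ω ^ q - ω)`.
  obtain ⟨b, hb⟩ : (x ^ q - x) / (ω ^ q - ω) ∈ (algebraMap F (CInf F)).range := by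
    refine mem_range_algebraMap_of_pow_card_eq ?_
    rw [← hfrob, map_div₀, map_sub, map_sub, hfrob_sq hx, hfrob_sq hω.pow_card_sq, hfrob, hfrob,
      ← neg_sub, ← neg_sub (ω ^ q), neg_div_neg_eq]
  have hbω := (div_eq_iff hne).1 hb.symm
  obtain ⟨a, ha⟩ : x - algebraMap F (CInf F) b * ω ∈ (algebraMap F (CInf F)).range := by
    refine mem_range_algebraMap_of_pow_card_eq ?_
    rw [← hfrob, map_sub, map_mul, hfrob, hfrob, hfrob, ← map_pow, FiniteField.pow_card]
    linear_combination hbω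
  exact ⟨a, b, by rw [ha]; ring⟩

end IsQuadraticGenerator

/-! ### Linear forms on the Anderson ring -/

section Closure

variable {R M : Type*} [Ring R] [AddCommGroup M] [Module R M] {s : Set R}

theorem mul_mem_of_mem_closure {S : AddSubgroup R} (hs : ∀ x ∈ S, ∀ a ∈ s, x * a ∈ S) {x p : R}
    (hx : x ∈ S) (hp : p ∈ Subring.closure s) : x * p ∈ S := by
  induction hp using Subring.closure_induction generalizing x with
  | mem a ha => exact hs x hx a ha
  | zero => simp only [mul_zero, zero_mem]
  | one => rwa [mul_one]
  | add a b _ _ iha ihb => exact mul_add x a b ▸ add_mem (iha hx) (ihb hx)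
  | neg a _ iha => exact mul_neg x a ▸ neg_mem (iha hx)
  | mul a b _ _ iha ihb => exact mul_assoc x a b ▸ ihb (iha hx)

theorem smul_mem_of_mem_closure {S : AddSubgroup M} (hs : ∀ a ∈ s, ∀ m ∈ S, a • m ∈ S) {r : R}
    (hr : r ∈ Subring.closure s) {m : M} (hm : m ∈ S) : r • m ∈ S := by
  induction hr using Subring.closure_induction generalizing m with
  | mem a ha => exact hs a ha m hm
  | zero => simp only [zero_smul, zero_mem]
  | one => rwa [one_smul]
  | add a b _ _ iha ihb => exact add_smul a b m ▸ add_mem (iha hm) (ihb hm)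
  | neg a _ iha => exact neg_smul a m ▸ neg_mem (iha hm)
  | mul a b _ _ iha ihb => exact mul_smul a b m ▸ iha (ihb hm)

theorem exists_mul_eq_mul_of_mem_closure {t : R}
    (ht : ∀ a ∈ s, ∃ a' ∈ Subring.closure s, t * a = a' * t) {p : R} (hp : p ∈ Subring.closure s) :
    ∃ p' ∈ Subring.closure s, t * p = p' * t := by
  induction hp using Subring.closure_induction with
  | mem a ha => exact ht a ha
  | zero => exact ⟨0, zero_mem _, by rw [mul_zero, zero_mul]⟩
  | one => exact ⟨1, one_mem _, by rw [mul_one, one_mul]⟩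
  | add a b _ _ iha ihb =>
    obtain ⟨⟨a', ha', ha⟩, b', hb', hb⟩ := And.intro iha ihb
    exact ⟨a' + b', add_mem ha' hb', by rw [mul_add, add_mul, ha, hb]⟩
  | neg a _ iha =>
    obtain ⟨a', ha', ha⟩ := iha
    exact ⟨-a', neg_mem ha', by rw [mul_neg, neg_mul, ha]⟩
  | mul a b _ _ iha ihb =>
    obtain ⟨⟨a', ha', ha⟩, b', hb', hb⟩ := And.intro iha ihb
    exact ⟨a' * b', mul_mem ha' hb', by rw [← mul_assoc, ha, mul_assoc, hb, mul_assoc]⟩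

theorem smul_mem_span_closure {t : R} {X : Set M}
    (ht : ∀ a ∈ s, ∃ a' ∈ Subring.closure s, t * a = a' * t)
    (hX : ∀ x ∈ X, t • x ∈ Submodule.span (Subring.closure s) X) {m : M}
    (hm : m ∈ Submodule.span (Subring.closure s) X) :
    t • m ∈ Submodule.span (Subring.closure s) X := by
  induction hm using Submodule.span_induction with
  | mem x hx => exact hX x hx
  | zero => simp only [smul_zero, zero_mem]
  | add x y _ _ hx hy => exact smul_add t x y ▸ add_mem hx hy
  | smul p x _ hx =>
    obtain ⟨p', hp', hcomm⟩ := exists_mul_eq_mul_of_mem_closure ht p.2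
    rw [Subring.smul_def, ← mul_smul, hcomm, mul_smul]
    exact Submodule.smul_mem _ (⟨p', hp'⟩ : Subring.closure s) hx

end Closure

namespace AndersonRing

theorem const_mul_T_pow_mul_tau_pow (c : CInf F) (j k : ℕ) :
    const F c * T F ^ j * tau F ^ k = SkewPolynomial.monomial k (Polynomial.monomial j c) := by
  have h : SkewPolynomial.C (Polynomial.C c) * SkewPolynomial.C Polynomial.X ^ j
      * SkewPolynomial.X ^ k = SkewPolynomial.monomial k (Polynomial.monomial j c) := by
    rw [← SkewPolynomial.C_pow, ← SkewPolynomial.C_mul, SkewPolynomial.C_mul_X_pow_eq_monomial,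
      Polynomial.C_mul_X_pow_eq_monomial]
  exact h

theorem addHom_ext {N : Type*} [AddCommGroup N] {f g : AndersonRing F →+ N}
    (h : ∀ c j k, f (const F c * T F ^ j * tau F ^ k) = g (const F c * T F ^ j * tau F ^ k)) :
    f = g := by
  simp only [const_mul_T_pow_mul_tau_pow] at h
  refine SkewMonoidAlgebra.addHom_ext fun k p => ?_
  induction p using Polynomial.induction_on' with
  | add p p' hp hp' =>
    rw [SkewMonoidAlgebra.single_add]
    exact (f.map_add _ _).trans ((congrArg₂ _ hp hp').trans (g.map_add _ _).symm)
  | monomial j c => exact h c j k.toAdd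

theorem tau_pow_mul_const (a : CInf F) (k : ℕ) :
    tau F ^ k * const F a = const F (a ^ q ^ k) * tau F ^ k := by
  induction k generalizing a with
  | zero => simp
  | succ k ih =>
    rw [pow_succ, mul_assoc, tau_mul_const, ← mul_assoc, ih, mul_assoc, ← pow_mul, ← pow_succ']

theorem monomial_mul_T (c : CInf F) (j k : ℕ) :
    const F c * T F ^ j * tau F ^ k * T F = const F c * T F ^ (j + 1) * tau F ^ k := by
  have hcomm : Commute (T F) (tau F ^ k) := Commute.pow_right (T_mul_tau F) k
  rw [mul_assoc, ← hcomm.eq, ← mul_assoc, mul_assoc (const F c), ← pow_succ]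

theorem monomial_mul_const (c a : CInf F) (j k : ℕ) :
    const F c * T F ^ j * tau F ^ k * const F a
      = const F (c * a ^ q ^ k) * T F ^ j * tau F ^ k := by
  have hcomm : Commute (T F ^ j) (const F (a ^ q ^ k)) := Commute.pow_left (T_mul_const F _) j
  rw [mul_assoc, tau_pow_mul_const, ← mul_assoc, mul_assoc (const F c), hcomm.eq, ← mul_assoc,
    ← map_mul]

theorem const_mul_monomial (a c : CInf F) (j k : ℕ) :
    const F a * (const F c * T F ^ j * tau F ^ k) = const F (a * c) * T F ^ j * tau F ^ k := by
  simp only [map_mul, mul_assoc]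

theorem tau_mul_monomial (c : CInf F) (j k : ℕ) :
    tau F * (const F c * T F ^ j * tau F ^ k) = const F (c ^ q) * T F ^ j * tau F ^ (k + 1) := by
  have hcomm : Commute (T F ^ j) (tau F) := Commute.pow_left (T_mul_tau F) j
  rw [mul_assoc, ← mul_assoc, tau_mul_const, mul_assoc, ← mul_assoc (tau F), ← hcomm.eq, mul_assoc,
    ← pow_succ', mul_assoc]

theorem mem_closure (r : AndersonRing F) :
    r ∈ Subring.closure (Set.range (const F) ∪ {T F, tau F}) := by
  set S := Subring.closure (Set.range (const F) ∪ {T F, tau F})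
  have hzero : QuotientAddGroup.mk' S.toAddSubgroup = 0 := addHom_ext fun c j k => by
    rw [AddMonoidHom.zero_apply, QuotientAddGroup.mk'_apply, QuotientAddGroup.eq_zero_iff]
    exact S.mul_mem (S.mul_mem (Subring.subset_closure (by simp))
      (S.pow_mem (Subring.subset_closure (by simp)) j))
      (S.pow_mem (Subring.subset_closure (by simp)) k)
  exact (QuotientAddGroup.eq_zero_iff r).1 (DFunLike.congr_fun hzero r)

/-- The pairing of a family `w` with an element `∑ cⱼₖ Tʲ τᵏ` of the Anderson ring, that is
`∑ cⱼₖ wⱼₖ`. The maps `pairing w` are the `C∞`-linear forms on the Anderson ring. -/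
def pairing (w : ℕ → ℕ → CInf F) : AndersonRing F →+ CInf F :=
  (Finsupp.liftAddHom fun k : Multiplicative ℕ =>
    (Polynomial.lsum (R := CInf F) fun j =>
      LinearMap.mulRight (CInf F) (w j k.toAdd)).toAddMonoidHom).comp
    (SkewMonoidAlgebra.coeffAddEquiv (k := Polynomial (CInf F))
      (G := Multiplicative ℕ)).toAddMonoidHom

theorem pairing_monomial (w : ℕ → ℕ → CInf F) (c : CInf F) (j k : ℕ) :
    pairing w (const F c * T F ^ j * tau F ^ k) = c * w j k := by
  rw [const_mul_T_pow_mul_tau_pow]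
  change Finsupp.liftAddHom _ (Finsupp.single _ _) = _
  rw [Finsupp.liftAddHom_apply_single]
  simp [Polynomial.lsum_apply, Polynomial.sum_monomial_index]

variable (F) in
/-- `AndersonRing.pairing` as an additive map in the family `w`. -/
def pairingHom : (ℕ → ℕ → CInf F) →+ AndersonRing F →+ CInf F :=
  AddMonoidHom.mk' pairing fun w w' => addHom_ext fun c j k => by
    simp only [AddMonoidHom.add_apply, pairing_monomial, Pi.add_apply, mul_add]

theorem pairingHom_apply (w : ℕ → ℕ → CInf F) : pairingHom F w = pairing w := rfl

theorem pairing_zero : pairing (0 : ℕ → ℕ → CInf F) = 0 := map_zero (pairingHom F)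

theorem pairing_one (w : ℕ → ℕ → CInf F) : pairing w 1 = w 0 0 := by
  simpa using pairing_monomial w 1 0 0

theorem pairing_mul_T (w : ℕ → ℕ → CInf F) (r : AndersonRing F) :
    pairing w (r * T F) = pairing (fun j k => w (j + 1) k) r := by
  have h : (pairing w).comp (AddMonoidHom.mulRight (T F)) = pairing fun j k => w (j + 1) k :=
    addHom_ext fun c j k => by simp [monomial_mul_T, pairing_monomial]
  exact DFunLike.congr_fun h r

theorem pairing_mul_tau (w : ℕ → ℕ → CInf F) (r : AndersonRing F) :
    pairing w (r * tau F) = pairing (fun j k => w j (k + 1)) r := by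
  have h : (pairing w).comp (AddMonoidHom.mulRight (tau F)) = pairing fun j k => w j (k + 1) :=
    addHom_ext fun c j k => by simp [mul_assoc _ _ (tau F), ← pow_succ, pairing_monomial]
  exact DFunLike.congr_fun h r

theorem pairing_mul_const (w : ℕ → ℕ → CInf F) (a : CInf F) (r : AndersonRing F) :
    pairing w (r * const F a) = pairing (fun j k => a ^ q ^ k * w j k) r := by
  have h : (pairing w).comp (AddMonoidHom.mulRight (const F a))
      = pairing fun j k => a ^ q ^ k * w j k :=
    addHom_ext fun c j k => by
      rw [AddMonoidHom.comp_apply, AddMonoidHom.mulRight_apply, monomial_mul_const,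
        pairing_monomial, pairing_monomial, mul_assoc]
  exact DFunLike.congr_fun h r

theorem pairing_const_mul (w : ℕ → ℕ → CInf F) (a : CInf F) (r : AndersonRing F) :
    pairing w (const F a * r) = a * pairing w r := by
  have h : (pairing w).comp (AddMonoidHom.mulLeft (const F a))
      = (AddMonoidHom.mulLeft a).comp (pairing w) :=
    addHom_ext fun c j k => by
      rw [AddMonoidHom.comp_apply, AddMonoidHom.comp_apply, AddMonoidHom.coe_mulLeft,
        AddMonoidHom.coe_mulLeft, const_mul_monomial, pairing_monomial, pairing_monomial, mul_assoc]
  exact DFunLike.congr_fun h r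

theorem pairing_tau_mul {w : ℕ → ℕ → CInf F} (hw : ∀ j k, w j (k + 1) = w j k ^ q)
    (r : AndersonRing F) : pairing w (tau F * r) = pairing w r ^ q := by
  have h : (pairing w).comp (AddMonoidHom.mulLeft (tau F))
      = (CInf.frob (F := F) 1).toAddMonoidHom.comp (pairing w) :=
    addHom_ext fun c j k => by
      rw [AddMonoidHom.comp_apply, AddMonoidHom.coe_mulLeft, tau_mul_monomial, pairing_monomial, hw]
      simp [pairing_monomial, CInf.frob_apply, mul_pow]
  simpa [CInf.frob_apply] using DFunLike.congr_fun h r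

theorem pairing_tau_mul_eq_zero {w : ℕ → ℕ → CInf F} (hw : ∀ j k, w j (k + 1) = 0)
    (r : AndersonRing F) : pairing w (tau F * r) = 0 := by
  have h : (pairing w).comp (AddMonoidHom.mulLeft (tau F)) = 0 :=
    addHom_ext fun c j k => by
      rw [AddMonoidHom.comp_apply, AddMonoidHom.coe_mulLeft, tau_mul_monomial, pairing_monomial, hw,
        mul_zero, AddMonoidHom.zero_apply]
  exact DFunLike.congr_fun h r

theorem pairing_single (j k : ℕ) (r : AndersonRing F) :
    pairing (Pi.single j (Pi.single k 1)) r = (SkewPolynomial.coeff r k).coeff j := by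
  let f : AndersonRing F →+ CInf F :=
    (Polynomial.lcoeff (CInf F) j).toAddMonoidHom.comp
      ((Finsupp.applyAddHom (Multiplicative.ofAdd k)).comp
        (SkewMonoidAlgebra.coeffAddEquiv (k := Polynomial (CInf F))
          (G := Multiplicative ℕ)).toAddMonoidHom)
  have h : pairing (Pi.single j (Pi.single k 1)) = f := addHom_ext fun c j' k' => by
    rw [pairing_monomial]
    change _ = (SkewPolynomial.coeff (const F c * T F ^ j' * tau F ^ k') k).coeff j
    rw [const_mul_T_pow_mul_tau_pow, SkewPolynomial.coeff_monomial]
    by_cases hk : k' = k <;> by_cases hj : j' = j <;> simp [hk, hj, Polynomial.coeff_monomial]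
  exact DFunLike.congr_fun h r

theorem eq_zero_of_forall_pairing_eq_zero {r : AndersonRing F} (h : ∀ w, pairing w r = 0) :
    r = 0 :=
  SkewMonoidAlgebra.ext fun k => Polynomial.ext fun j =>
    (pairing_single j k.toAdd r).symm.trans (h _)

theorem pairing_congr_of_mem_polyTau {w w' : ℕ → ℕ → CInf F} (h : w 0 = w' 0)
    {p : AndersonRing F} (hp : p ∈ polyTau F) : pairing w p = pairing w' p := by
  let S : AddSubgroup (AndersonRing F) := ⨅ v : {v : ℕ → ℕ → CInf F // v 0 = 0}, (pairing v.1).ker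
  have hS {r} : r ∈ S ↔ ∀ v : ℕ → ℕ → CInf F, v 0 = 0 → pairing v r = 0 := by
    simp [S, AddSubgroup.mem_iInf]
  have hstable : ∀ r ∈ S, ∀ a ∈ Set.range (const F) ∪ {tau F}, r * a ∈ S := by
    simp only [hS]
    rintro r hr _ (⟨a, rfl⟩ | rfl) v hv
    · exact (pairing_mul_const v a r).trans (hr _ (by simp [hv, funext_iff]))
    · exact (pairing_mul_tau v r).trans (hr _ (by simp [hv, funext_iff]))
  have hone : (1 : AndersonRing F) ∈ S := hS.2 fun v hv => by rw [pairing_one, hv, Pi.zero_apply]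
  have hpS := hS.1 (mul_mem_of_mem_closure hstable hone hp) (w - w') (by simp [h])
  rwa [one_mul, ← pairingHom_apply, map_sub, AddMonoidHom.sub_apply, sub_eq_zero] at hpS

theorem pairing_congr_of_mem_polyT {w w' : ℕ → ℕ → CInf F} (h : ∀ j, w j 0 = w' j 0)
    {p : AndersonRing F} (hp : p ∈ polyT F) : pairing w p = pairing w' p := by
  let S : AddSubgroup (AndersonRing F) :=
    ⨅ v : {v : ℕ → ℕ → CInf F // ∀ j, v j 0 = 0}, (pairing v.1).ker
  have hS {r} : r ∈ S ↔ ∀ v : ℕ → ℕ → CInf F, (∀ j, v j 0 = 0) → pairing v r = 0 := by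
    simp [S, AddSubgroup.mem_iInf]
  have hstable : ∀ r ∈ S, ∀ a ∈ Set.range (const F) ∪ {T F}, r * a ∈ S := by
    simp only [hS]
    rintro r hr _ (⟨a, rfl⟩ | rfl) v hv
    · exact (pairing_mul_const v a r).trans (hr _ (by simp [hv]))
    · exact (pairing_mul_T v r).trans (hr _ (by simp [hv]))
  have hone : (1 : AndersonRing F) ∈ S := hS.2 fun v hv => by rw [pairing_one, hv]
  have hpS := hS.1 (mul_mem_of_mem_closure hstable hone hp) (w - w') (by simp [h])
  rwa [one_mul, ← pairingHom_apply, map_sub, AddMonoidHom.sub_apply, sub_eq_zero] at hpS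

theorem linearIndependent_of_exists_addMonoidHom {ι M : Type*} [Finite ι] [AddCommGroup M]
    [Module (AndersonRing F) M] {R : Subring (AndersonRing F)} {v : ι → M}
    (h : ∀ w : ι → ℕ → ℕ → CInf F, ∃ φ : M →+ CInf F,
      ∀ i, ∀ p ∈ R, φ (p • v i) = pairing (w i) p) : LinearIndependent R v := by
  classical
  cases nonempty_fintype ι
  refine Fintype.linearIndependent_iff.2 fun g hg i => Subtype.ext ?_
  refine eq_zero_of_forall_pairing_eq_zero fun w => ?_
  obtain ⟨φ, hφ⟩ := h fun l => if l = i then w else 0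
  have hsum : ∑ l, pairing (if l = i then w else 0) (g l : AndersonRing F)
      = φ (∑ l, g l • v l) := by
    rw [map_sum]
    exact Finset.sum_congr rfl fun l _ => (hφ l _ (g l).2).symm
  rw [hg, map_zero, Finset.sum_eq_single i] at hsum
  · rwa [if_pos rfl] at hsum
  · intro l _ hl
    rw [if_neg hl, pairing_zero, AddMonoidHom.zero_apply]
  · exact fun hi => absurd (Finset.mem_univ i) hi

theorem const_mem_polyTau (a : CInf F) : const F a ∈ polyTau F :=
  Subring.subset_closure (Or.inl ⟨a, rfl⟩)

theorem tau_mem_polyTau : tau F ∈ polyTau F := Subring.subset_closure (Or.inr rfl)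

theorem const_mem_polyT (a : CInf F) : const F a ∈ polyT F :=
  Subring.subset_closure (Or.inl ⟨a, rfl⟩)

theorem T_mem_polyT : T F ∈ polyT F := Subring.subset_closure (Or.inr rfl)

theorem exists_T_mul_eq {a : AndersonRing F} (ha : a ∈ Set.range (const F) ∪ {tau F}) :
    ∃ a' ∈ polyTau F, T F * a = a' * T F := by
  refine ⟨a, Subring.subset_closure ha, ?_⟩
  rcases ha with ⟨c, rfl⟩ | rfl
  exacts [T_mul_const F c, T_mul_tau F]

theorem exists_tau_mul_eq {a : AndersonRing F} (ha : a ∈ Set.range (const F) ∪ {T F}) :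
    ∃ a' ∈ polyT F, tau F * a = a' * tau F := by
  rcases ha with ⟨c, rfl⟩ | rfl
  exacts [⟨_, const_mem_polyT _, tau_mul_const F c⟩, ⟨_, T_mem_polyT, (T_mul_tau F).symm⟩]

end AndersonRing

/-! ### Bases and points of `M(A)` -/

namespace Motive

open AndersonRing

variable {n : ℕ} {A : Matrix (Fin n) (Fin n) (CInf F)}

theorem mk_eq_sum (v : Fin n → AndersonRing F) :
    (Submodule.Quotient.mk v : Motive A) = ∑ i, v i • e A i := by
  conv_lhs => rw [pi_eq_sum_univ' v]
  rw [← Submodule.mkQ_apply, map_sum]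
  exact Finset.sum_congr rfl fun i _ => rfl

theorem mk_single (i : Fin n) (r : AndersonRing F) :
    (Submodule.Quotient.mk (Pi.single i r) : Motive A) = r • e A i := by
  rw [e, ← Submodule.Quotient.mk_smul, ← Pi.single_smul, smul_eq_mul, mul_one]

variable (A) in
theorem T_smul_e (i : Fin n) :
    T F • e A i = const F (CInf.theta F) • e A i + ∑ j, const F (A i j) • tau F • e A j
      + tau F • tau F • e A i := by
  have h : (Submodule.Quotient.mk (motiveRelation A i) : Motive A) = 0 :=
    (Submodule.Quotient.mk_eq_zero _).2 (Submodule.subset_span ⟨i, rfl⟩)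
  rw [motiveRelation, ← Submodule.mkQ_apply, map_sub, map_add, map_add, map_sum] at h
  simpa only [Submodule.mkQ_apply, mk_single, mul_smul, sq] using sub_eq_zero.1 h

variable (A) in
theorem tau_smul_tau_smul_e (i : Fin n) :
    tau F • tau F • e A i = T F • e A i - const F (CInf.theta F) • e A i
      - ∑ j, const F (A i j) • tau F • e A j := by
  rw [T_smul_e]
  abel

theorem mem_of_smul_e_mem {S : AddSubgroup (Motive A)}
    (h : ∀ i, ∀ r : AndersonRing F, r • e A i ∈ S) (m : Motive A) : m ∈ S := by
  obtain ⟨v, rfl⟩ := Submodule.Quotient.mk_surjective _ m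
  exact mk_eq_sum v ▸ sum_mem fun i _ => h i (v i)

variable (A) in
theorem span_polyTau : Submodule.span (polyTau F) (Set.range (e A)) = ⊤ := by
  set S := Submodule.span (polyTau F) (Set.range (e A))
  have hS : ∀ r ∈ polyTau F, ∀ m ∈ S, r • m ∈ S := fun r hr _ => S.smul_mem ⟨r, hr⟩
  have he i : e A i ∈ S := Submodule.subset_span ⟨i, rfl⟩
  have heτ i : tau F • e A i ∈ S := hS _ tau_mem_polyTau _ (he i)
  have hT : ∀ m ∈ S, T F • m ∈ S := fun m => by
    refine smul_mem_span_closure (fun a => exists_T_mul_eq) ?_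
    rintro _ ⟨i, rfl⟩
    rw [T_smul_e]
    exact add_mem (add_mem (hS _ (const_mem_polyTau _) _ (he i))
      (sum_mem fun j _ => hS _ (const_mem_polyTau _) _ (heτ j)))
      (hS _ tau_mem_polyTau _ (heτ i))
  refine eq_top_iff.2 fun m _ => mem_of_smul_e_mem (S := S.toAddSubgroup) (fun i r => ?_) m
  refine smul_mem_of_mem_closure ?_ (mem_closure r) (he i)
  rintro _ (⟨a, rfl⟩ | rfl | rfl)
  exacts [hS _ (const_mem_polyTau a), hT, hS _ tau_mem_polyTau]

variable (A) in
/-- The `C∞[T]`-basis `e₁, …, eₙ, τe₁, …, τeₙ` of `M(A)`. -/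
def eTau : Fin n ⊕ Fin n → Motive A := Sum.elim (e A) fun i => tau F • e A i

variable (A) in
theorem span_polyT : Submodule.span (polyT F) (Set.range (eTau A)) = ⊤ := by
  set S := Submodule.span (polyT F) (Set.range (eTau A))
  have hS : ∀ r ∈ polyT F, ∀ m ∈ S, r • m ∈ S := fun r hr _ => S.smul_mem ⟨r, hr⟩
  have he i : e A i ∈ S := Submodule.subset_span ⟨Sum.inl i, rfl⟩
  have heτ i : tau F • e A i ∈ S := Submodule.subset_span ⟨Sum.inr i, rfl⟩
  have hτ : ∀ m ∈ S, tau F • m ∈ S := fun m => by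
    refine smul_mem_span_closure (fun a => exists_tau_mul_eq) ?_
    rintro _ ⟨i | i, rfl⟩
    · exact heτ i
    · rw [eTau, Sum.elim_inr, tau_smul_tau_smul_e]
      exact sub_mem (sub_mem (hS _ T_mem_polyT _ (he i)) (hS _ (const_mem_polyT _) _ (he i)))
        (sum_mem fun j _ => hS _ (const_mem_polyT _) _ (heτ j))
  refine eq_top_iff.2 fun m _ => mem_of_smul_e_mem (S := S.toAddSubgroup) (fun i r => ?_) m
  refine smul_mem_of_mem_closure ?_ (mem_closure r) (he i)
  rintro _ (⟨a, rfl⟩ | rfl | rfl)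
  exacts [hS _ (const_mem_polyT a), hS _ T_mem_polyT, hτ]

theorem mem_of_const_smul_mem_of_tau_smul_mem {S : AddSubgroup (Motive A)}
    (hconst : ∀ a, ∀ m ∈ S, const F a • m ∈ S) (hτ : ∀ m ∈ S, tau F • m ∈ S)
    (he : ∀ i, e A i ∈ S) (m : Motive A) : m ∈ S := by
  have hm : m ∈ Submodule.span (polyTau F) (Set.range (e A)) := span_polyTau A ▸ trivial
  induction hm using Submodule.span_induction with
  | mem x hx => exact hx.choose_spec ▸ he _
  | zero => exact zero_mem S
  | add x y _ _ hx hy => exact add_mem hx hy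
  | smul r x _ hx =>
    refine smul_mem_of_mem_closure ?_ r.2 hx
    rintro _ (⟨a, rfl⟩ | rfl)
    exacts [hconst a, hτ]

variable (A) in
/-- The condition on a family `w` under which `Tʲ τᵏ eᵢ ↦ w i j k` extends to a `C∞`-linear form
on `M(A)`. -/
def IsCompatible (w : Fin n → ℕ → ℕ → CInf F) : Prop :=
  ∀ i j k, w i (j + 1) k = CInf.theta F ^ q ^ k * w i j k
    + ∑ l, A i l ^ q ^ k * w l j (k + 1) + w i j (k + 2)

theorem IsCompatible.pairing_mul_T {w : Fin n → ℕ → ℕ → CInf F} (hw : IsCompatible A w)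
    (i : Fin n) (r : AndersonRing F) :
    pairing (w i) (r * T F) = pairing (w i) (r * const F (CInf.theta F))
      + ∑ l, pairing (w l) (r * (const F (A i l) * tau F)) + pairing (w i) (r * tau F ^ 2) := by
  have hwi : (fun j k => w i (j + 1) k) = (fun j k => CInf.theta F ^ q ^ k * w i j k)
      + ∑ l, (fun j k => A i l ^ q ^ k * w l j (k + 1)) + fun j k => w i j (k + 2) := by
    funext j k
    simpa only [Pi.add_apply, Finset.sum_apply] using hw i j k
  simp only [AndersonRing.pairing_mul_T, sq, ← mul_assoc, pairing_mul_tau, pairing_mul_const, hwi]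
  simp only [← pairingHom_apply, map_add,
    map_sum, AddMonoidHom.add_apply, AddMonoidHom.finsetSum_apply]

theorem exists_addMonoidHom_of_isCompatible {w : Fin n → ℕ → ℕ → CInf F}
    (hw : IsCompatible A w) :
    ∃ φ : Motive A →+ CInf F, ∀ i r, φ (r • e A i) = pairing (w i) r := by
  let ψ : (Fin n → AndersonRing F) →+ CInf F :=
    ∑ i, (pairing (w i)).comp (Pi.evalAddMonoidHom (fun _ => AndersonRing F) i)
  have hψ i r : ψ (Pi.single i r) = pairing (w i) r := by
    rw [AddMonoidHom.finsetSum_apply, Finset.sum_eq_single i]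
    · simp
    · intro j _ hj
      simp [hj]
    · simp
  have hψrel (r : AndersonRing F) i : ψ (r • motiveRelation A i) = 0 := by
    simp only [motiveRelation, smul_sub, smul_add, Finset.smul_sum, map_sub, map_add, map_sum,
      ← Pi.single_smul, smul_eq_mul, hψ]
    rw [hw.pairing_mul_T, sub_self]
  refine ⟨QuotientAddGroup.lift
    (Submodule.span (AndersonRing F) (Set.range (motiveRelation A))).toAddSubgroup ψ fun v hv => ?_,
    fun i r => ?_⟩
  · obtain ⟨b, rfl⟩ := (Submodule.mem_span_range_iff_exists_fun _).1 hv
    rw [AddMonoidHom.mem_ker, map_sum]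
    exact Finset.sum_eq_zero fun i _ => hψrel _ _
  · rw [← mk_single]
    exact hψ i r

variable (A) in
/-- The compatible family `w i j k = extendT A u j i k` with `w i 0 k = u i k`. -/
def extendT (u : Fin n → ℕ → CInf F) : ℕ → Fin n → ℕ → CInf F
  | 0 => u
  | j + 1 => fun i k => CInf.theta F ^ q ^ k * extendT u j i k
      + ∑ l, A i l ^ q ^ k * extendT u j l (k + 1) + extendT u j i (k + 2)

variable (A) in
/-- The compatible family `w i j k = extendTau A u₀ u₁ k i j` with `w i j 0 = u₀ i j` and
`w i j 1 = u₁ i j`. -/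
def extendTau (u₀ u₁ : Fin n → ℕ → CInf F) : ℕ → Fin n → ℕ → CInf F
  | 0 => u₀
  | 1 => u₁
  | k + 2 => fun i j => extendTau u₀ u₁ k i (j + 1) - CInf.theta F ^ q ^ k * extendTau u₀ u₁ k i j
      - ∑ l, A i l ^ q ^ k * extendTau u₀ u₁ (k + 1) l j

variable (A) in
theorem linearIndependent_polyTau : LinearIndependent (polyTau F) (e A) := by
  refine linearIndependent_of_exists_addMonoidHom fun w => ?_
  have hw : IsCompatible A fun i j k => extendT A (fun i => w i 0) j i k := fun i j k => by
    simp only [extendT]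
  obtain ⟨φ, hφ⟩ := exists_addMonoidHom_of_isCompatible hw
  refine ⟨φ, fun i p hp => (hφ i p).trans (pairing_congr_of_mem_polyTau (w' := w i) ?_ hp)⟩
  simp only [extendT]

variable (A) in
theorem linearIndependent_polyT : LinearIndependent (polyT F) (eTau A) := by
  refine linearIndependent_of_exists_addMonoidHom fun w => ?_
  have hw : IsCompatible A fun i j k =>
      extendTau A (fun i j => w (.inl i) j 0) (fun i j => w (.inr i) j 0) k i j := fun i j k => by
    simp only [extendTau]
    ring
  obtain ⟨φ, hφ⟩ := exists_addMonoidHom_of_isCompatible hw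
  refine ⟨φ, ?_⟩
  rintro (i | i) p hp
  · refine (hφ i p).trans (pairing_congr_of_mem_polyT (w' := w (.inl i)) (fun j => ?_) hp)
    simp only [extendTau]
  · rw [eTau, Sum.elim_inr, ← mul_smul, hφ, pairing_mul_tau]
    refine pairing_congr_of_mem_polyT (w' := w (.inr i)) (fun j => ?_) hp
    simp only [extendTau]

theorem exists_tau_smul_eq (m : Motive A) :
    ∃ y : Motive A, tau F • y = (T F - const F (CInf.theta F)) • m := by
  let τM : AddSubgroup (Motive A) := (DistribSMul.toAddMonoidHom (Motive A) (tau F)).range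
  have hτM m : tau F • m ∈ τM := ⟨m, rfl⟩
  have hconst : ∀ a, ∀ m ∈ τM, const F a • m ∈ τM := by
    rintro a _ ⟨m, rfl⟩
    obtain ⟨b, rfl⟩ := CInf.frob_surjective 1 a
    refine ⟨const F b • m, ?_⟩
    rw [DistribSMul.toAddMonoidHom_apply, DistribSMul.toAddMonoidHom_apply, ← mul_smul, ← mul_smul,
      tau_mul_const, CInf.frob_apply, pow_one]
  suffices hm : m ∈ τM.comap (DistribSMul.toAddMonoidHom _ (T F - const F (CInf.theta F))) from hm
  refine mem_of_const_smul_mem_of_tau_smul_mem (fun a m hm => ?_) (fun m _ => ?_) (fun i => ?_) m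
    <;> rw [AddSubgroup.mem_comap, DistribSMul.toAddMonoidHom_apply] at *
  · have hcomm : (T F - const F (CInf.theta F)) * const F a
        = const F a * (T F - const F (CInf.theta F)) := by
      rw [sub_mul, mul_sub, T_mul_const, ← map_mul, ← map_mul, mul_comm a]
    rw [← mul_smul, hcomm, mul_smul]
    exact hconst a _ hm
  · rw [sub_smul, ← mul_smul, T_mul_tau, mul_smul]
    exact sub_mem (hτM _) (hconst _ _ (hτM m))
  · rw [sub_smul, T_smul_e, add_assoc, add_sub_cancel_left]
    exact add_mem (sum_mem fun j _ => hconst _ _ (hτM _)) (hτM _)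

variable (A) in
theorem isTMotive : IsTMotive F n (2 * n) (Motive A) where
  free_tau := ⟨Module.Basis.mk (linearIndependent_polyTau A) (span_polyTau A).ge⟩
  free_T := ⟨(Module.Basis.mk (linearIndependent_polyT A) (span_polyT A).ge).reindex
    (finSumFinEquiv.trans (finCongr (two_mul n).symm))⟩
  nilpotent := ⟨1, fun m => by simpa only [pow_one, eq_comm] using exists_tau_smul_eq m⟩

variable (A) in
/-- The action of `T` on `E(M(A))` in the coordinates given by `e₁, …, eₙ`. -/
def tAct : (Fin n → CInf F) →+ (Fin n → CInf F) :=
  AddMonoidHom.mk' (fun x => CInf.theta F • x + A *ᵥ x ^ q + x ^ q ^ 2) fun x y => by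
    have h := add_pow_card_pow (F := F) x y 1
    rw [pow_one] at h
    simp only [h, add_pow_card_pow, smul_add, Matrix.mulVec_add]
    abel

theorem tAct_apply (x : Fin n → CInf F) :
    tAct A x = CInf.theta F • x + A *ᵥ x ^ q + x ^ q ^ 2 := rfl

theorem const_smul_of_smul_e {φ : Motive A →+ CInf F} {w : Fin n → ℕ → ℕ → CInf F}
    (hφ : ∀ i r, φ (r • e A i) = pairing (w i) r) (a : CInf F) (m : Motive A) :
    φ (const F a • m) = a * φ m := by
  refine mem_of_smul_e_mem (S := AddMonoidHom.eqLocus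
    (φ.comp (DistribSMul.toAddMonoidHom _ (const F a))) ((AddMonoidHom.mulLeft a).comp φ))
    (fun i r => ?_) m
  change φ (const F a • r • e A i) = a * φ (r • e A i)
  rw [← mul_smul, hφ, hφ, pairing_const_mul]

theorem exists_tPoints (x : Fin n → CInf F) :
    ∃ f : TPoints F (Motive A), ∀ i, (f : Motive A →+ CInf F) (e A i) = x i := by
  obtain ⟨φ, hφ⟩ := exists_addMonoidHom_of_isCompatible (A := A)
    (w := fun i j k => ((tAct A)^[j] x) i ^ q ^ k) fun i j k => by
      beta_reduce
      rw [Function.iterate_succ_apply']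
      simp only [tAct_apply, Pi.add_apply, Pi.smul_apply, Pi.pow_apply, smul_eq_mul, Matrix.mulVec,
        dotProduct]
      simp only [← CInf.frob_apply, map_add, map_mul, map_sum, map_pow]
      simp only [CInf.frob_apply, ← pow_mul, ← pow_succ, ← pow_add, add_comm 2]
  refine ⟨⟨φ, const_smul_of_smul_e hφ, fun m => ?_⟩, fun i => ?_⟩
  · refine mem_of_smul_e_mem (S := AddMonoidHom.eqLocus
      (φ.comp (DistribSMul.toAddMonoidHom _ (tau F))) ((CInf.frob 1).toAddMonoidHom.comp φ))
      (fun i r => ?_) m |>.trans (by simp [CInf.frob_apply])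
    change φ (tau F • r • e A i) = φ (r • e A i) ^ q ^ 1
    rw [← mul_smul, hφ, hφ, pow_one, pairing_tau_mul fun j k => by rw [pow_succ, pow_mul]]
  · have h := hφ i 1
    rw [one_smul, pairing_one] at h
    simpa using h

theorem exists_tLie (z : Fin n → CInf F) :
    ∃ f : TLie F (Motive A), ∀ i, (f : Motive A →+ CInf F) (e A i) = z i := by
  obtain ⟨φ, hφ⟩ := exists_addMonoidHom_of_isCompatible (A := A)
    (w := fun i j k => if k = 0 then CInf.theta F ^ j * z i else 0) fun i j k => by
      by_cases hk : k = 0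
      · simp [hk, pow_succ', mul_assoc]
      · simp [hk]
  refine ⟨⟨φ, const_smul_of_smul_e hφ, fun m => ?_⟩, fun i => ?_⟩
  · refine mem_of_smul_e_mem (S := (φ.comp (DistribSMul.toAddMonoidHom _ (tau F))).ker)
      (fun i r => ?_) m
    change φ (tau F • r • e A i) = 0
    rw [← mul_smul, hφ, pairing_tau_mul_eq_zero fun j k => if_neg k.succ_ne_zero]
  · have h := hφ i 1
    rw [one_smul, pairing_one] at h
    simpa using h

theorem tPoints_ext {f g : TPoints F (Motive A)}
    (h : ∀ i, (f : Motive A →+ CInf F) (e A i) = (g : Motive A →+ CInf F) (e A i)) : f = g := by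
  refine Subtype.ext (AddMonoidHom.ext fun m => ?_)
  refine mem_of_const_smul_mem_of_tau_smul_mem (S := AddMonoidHom.eqLocus f.1 g.1)
    (fun a m hm => ?_) (fun m hm => ?_) h m <;> change f.1 _ = g.1 _ at hm ⊢
  exacts [by rw [f.2.1, g.2.1, hm], by rw [f.2.2, g.2.2, hm]]

theorem tLie_ext {f g : TLie F (Motive A)}
    (h : ∀ i, (f : Motive A →+ CInf F) (e A i) = (g : Motive A →+ CInf F) (e A i)) : f = g := by
  refine Subtype.ext (AddMonoidHom.ext fun m => ?_)
  refine mem_of_const_smul_mem_of_tau_smul_mem (S := AddMonoidHom.eqLocus f.1 g.1)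
    (fun a m hm => ?_) (fun m hm => ?_) h m <;> change f.1 _ = g.1 _ at hm ⊢
  exacts [by rw [f.2.1, g.2.1, hm], by rw [f.2.2, g.2.2]]

variable (A) in
/-- The coordinates on `E(M(A))` given by evaluation at `e₁, …, eₙ`. -/
def tPointsEquiv : TPoints F (Motive A) ≃ (Fin n → CInf F) :=
  Equiv.ofBijective (fun f i => (f : Motive A →+ CInf F) (e A i))
    ⟨fun _ _ h => tPoints_ext (congrFun h), fun x => (exists_tPoints x).imp fun _ => funext⟩

variable (A) in
/-- The coordinates on `Lie(M(A))` given by evaluation at `e₁, …, eₙ`. -/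
def tLieEquiv : TLie F (Motive A) ≃ (Fin n → CInf F) :=
  Equiv.ofBijective (fun f i => (f : Motive A →+ CInf F) (e A i))
    ⟨fun _ _ h => tLie_ext (congrFun h), fun z => (exists_tLie z).imp fun _ => funext⟩

theorem tPointsEquiv_apply (f : TPoints F (Motive A)) (i : Fin n) :
    tPointsEquiv A f i = (f : Motive A →+ CInf F) (e A i) := rfl

theorem tLieEquiv_apply (f : TLie F (Motive A)) (i : Fin n) :
    tLieEquiv A f i = (f : Motive A →+ CInf F) (e A i) := rfl

theorem tPointsEquiv_zero : tPointsEquiv A 0 = 0 := rfl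

theorem tPointsEquiv_T (f : TPoints F (Motive A)) :
    tPointsEquiv A (TPoints.T f) = tAct A (tPointsEquiv A f) := by
  funext i
  change f.1 (T F • e A i) = _
  rw [T_smul_e, map_add, map_add, map_sum, f.2.1, f.2.2, f.2.2]
  simp only [f.2.1, f.2.2, ← pow_mul, ← sq]
  rfl

theorem tLieEquiv_T (f : TLie F (Motive A)) :
    tLieEquiv A (TLie.T f) = CInf.theta F • tLieEquiv A f := by
  funext i
  change f.1 (T F • e A i) = _
  rw [T_smul_e, map_add, map_add, map_sum, f.2.1, f.2.2]
  simp only [f.2.1, f.2.2, mul_zero, Finset.sum_const_zero, add_zero]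
  rfl

end Motive

/-! ### Estimates for the coefficients of the exponential -/

section Ultrametric

variable {R m n p : Type*} [NonUnitalSeminormedRing R] [IsUltrametricDist R] [Fintype m]
  [Fintype n] [Fintype p]

instance matrix_isUltrametricDist : IsUltrametricDist (Matrix m n R) :=
  inferInstanceAs (IsUltrametricDist (m → n → R))

theorem norm_mulVec_le (M : Matrix m n R) (v : n → R) : ‖M *ᵥ v‖ ≤ ‖M‖ * ‖v‖ := by
  refine (pi_norm_le_iff_of_nonneg (by positivity)).2 fun i => ?_
  refine IsUltrametricDist.norm_sum_le_of_forall_le_of_nonneg (by positivity) fun j _ => ?_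
  exact (norm_mul_le _ _).trans
    (mul_le_mul (M.norm_entry_le_entrywise_sup_norm) (norm_le_pi_norm v j) (norm_nonneg _)
      (norm_nonneg _))

theorem norm_matrix_mul_le (M : Matrix m n R) (N : Matrix n p R) : ‖M * N‖ ≤ ‖M‖ * ‖N‖ := by
  refine (Matrix.norm_le_iff (by positivity)).2 fun i j => ?_
  refine IsUltrametricDist.norm_sum_le_of_forall_le_of_nonneg (by positivity) fun k _ => ?_
  exact (norm_mul_le _ _).trans
    (mul_le_mul (M.norm_entry_le_entrywise_sup_norm) (N.norm_entry_le_entrywise_sup_norm)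
      (norm_nonneg _) (norm_nonneg _))

end Ultrametric

theorem pi_norm_pow {ι K : Type*} [Fintype ι] [NormedDivisionRing K] (x : ι → K) {m : ℕ}
    (hm : m ≠ 0) : ‖x ^ m‖ = ‖x‖ ^ m := by
  have h : ‖x ^ m‖₊ = ‖x‖₊ ^ m := by
    simp only [Pi.nnnorm_def, Pi.pow_apply, nnnorm_pow]
    exact (Finset.apply_sup_eq_sup_comp (· ^ m) (fun a b => (pow_left_mono m).map_sup a b)
      (by simp [hm])).symm
  exact congrArg NNReal.toReal h

theorem CInf.norm_map_frob_le {m n : Type*} [Fintype m] [Fintype n] (M : Matrix m n (CInf F))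
    (k : ℕ) : ‖M.map (frob k)‖ ≤ ‖M‖ ^ q ^ k := by
  refine (Matrix.norm_le_iff (by positivity)).2 fun i j => ?_
  rw [Matrix.map_apply, frob_apply, norm_pow]
  exact pow_le_pow_left₀ (norm_nonneg _) M.norm_entry_le_entrywise_sup_norm _

section Radii

variable (F) in
/-- The absolute value `q ^ (1 / (q² - 1))` of the nonzero `T`-torsion points of `E(M(0))`. -/
def torsionRadius : ℝ := (q : ℝ) ^ ((q ^ 2 - 1 : ℕ) : ℝ)⁻¹

variable (F) in
/-- The absolute value of the shortest periods of `M(0)`. -/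
def periodRadius : ℝ := q * torsionRadius F

theorem one_lt_card : 1 < (q : ℝ) := by exact_mod_cast Fintype.one_lt_card

theorem card_pos : 0 < (q : ℝ) := zero_lt_one.trans one_lt_card

theorem card_pow_ne_zero (k : ℕ) : q ^ k ≠ 0 := pow_ne_zero _ Fintype.card_ne_zero

theorem card_sq_sub_one_ne_zero : q ^ 2 - 1 ≠ 0 :=
  (Nat.sub_pos_of_lt (Nat.one_lt_pow two_ne_zero Fintype.one_lt_card)).ne'

theorem torsionRadius_pow : torsionRadius F ^ (q ^ 2 - 1) = q :=
  Real.rpow_inv_natCast_pow (Nat.cast_nonneg _) card_sq_sub_one_ne_zero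

theorem one_lt_torsionRadius : 1 < torsionRadius F := by
  have h0 : 0 ≤ torsionRadius F := Real.rpow_nonneg (Nat.cast_nonneg _) _
  rw [← one_lt_pow_iff_of_nonneg h0 (card_sq_sub_one_ne_zero (F := F)), torsionRadius_pow]
  exact one_lt_card

theorem torsionRadius_pos : 0 < torsionRadius F := zero_lt_one.trans one_lt_torsionRadius

theorem torsionRadius_le_card : torsionRadius F ≤ q :=
  (le_self_pow₀ one_lt_torsionRadius.le card_sq_sub_one_ne_zero).trans_eq torsionRadius_pow

theorem periodRadius_pos : 0 < periodRadius F := mul_pos card_pos torsionRadius_pos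

theorem torsionRadius_lt_periodRadius : torsionRadius F < periodRadius F :=
  lt_mul_of_one_lt_left torsionRadius_pos one_lt_card

variable (F) in
/-- A bound for the `k`-th coefficient of the exponential of `M(A)` when `‖A‖ ≤ 1`. The exponent
`⌈k / 2⌉` reflects that only the leading coefficient `τ²` of `T` is a unit. -/
def expBound (k : ℕ) : ℝ := ((q : ℝ) ^ q ^ k)⁻¹ ^ ((k + 1) / 2)

theorem expBound_nonneg (k : ℕ) : 0 ≤ expBound F k := by unfold expBound; positivity

theorem expBound_le_one (k : ℕ) : expBound F k ≤ 1 :=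
  pow_le_one₀ (by positivity) (inv_le_one_of_one_le₀ (one_le_pow₀ one_lt_card.le))

omit [Field F] in
theorem expBound_pow (j k : ℕ) :
    expBound F k ^ q ^ j = ((q : ℝ) ^ q ^ (k + j))⁻¹ ^ ((k + 1) / 2) := by
  simp only [expBound, inv_pow, ← pow_mul]
  congr 2
  ring

omit [Field F] in
theorem inv_mul_expBound_pow_le {k : ℕ} :
    ((q : ℝ) ^ q ^ (k + 2))⁻¹ * expBound F k ^ q ^ 2 ≤ expBound F (k + 2) := by
  rw [expBound_pow, expBound, ← pow_succ', show (k + 2 + 1) / 2 = (k + 1) / 2 + 1 by omega]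

theorem inv_mul_expBound_succ_pow_le {k : ℕ} :
    ((q : ℝ) ^ q ^ (k + 2))⁻¹ * expBound F (k + 1) ^ q ≤ expBound F (k + 2) := by
  have h := expBound_pow (F := F) 1 (k + 1)
  rw [pow_one] at h
  rw [h, expBound, ← pow_succ']
  exact pow_le_pow_of_le_one (by positivity)
    (inv_le_one_of_one_le₀ (one_le_pow₀ one_lt_card.le)) (by omega)

omit [Field F] in
theorem expBound_mul_pow (k : ℕ) (r : ℝ) :
    expBound F k * r ^ q ^ k = (r * (q : ℝ)⁻¹ ^ ((k + 1) / 2)) ^ q ^ k := by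
  rw [expBound, mul_pow, ← inv_pow, ← pow_mul, ← pow_mul, mul_comm, mul_comm (q ^ k)]

variable (F) in
/-- The contraction factor of `z ↦ Exp z - z` on the ball of radius `r`. -/
def contraction (r : ℝ) : ℝ := max 1 (r / q) ^ (q ^ 2 - 1) / q

theorem contraction_nonneg (r : ℝ) : 0 ≤ contraction F r := by unfold contraction; positivity

theorem contraction_le_one {r : ℝ} (hr : r ≤ periodRadius F) : contraction F r ≤ 1 := by
  rw [contraction, div_le_one card_pos]
  conv_rhs => rw [← torsionRadius_pow]
  refine pow_le_pow_left₀ (by positivity) (max_le one_lt_torsionRadius.le ?_) _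
  rwa [div_le_iff₀' card_pos]

theorem contraction_lt_one {r : ℝ} (hr : r < periodRadius F) : contraction F r < 1 := by
  rw [contraction, div_lt_one card_pos]
  conv_rhs => rw [← torsionRadius_pow]
  refine pow_lt_pow_left₀ (max_lt one_lt_torsionRadius ?_) (by positivity) card_sq_sub_one_ne_zero
  rwa [div_lt_iff₀' card_pos]

theorem pow_le_pow_sub_one_mul {s t : ℝ} (ht : 0 ≤ t) (hts : t ≤ s) (hs : 1 ≤ s) {a b : ℕ}
    (ha : a ≠ 0) (hab : a ≤ b) : t ^ a ≤ s ^ (b - 1) * t := by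
  rw [← Nat.sub_one_add_one ha, pow_succ]
  refine mul_le_mul_of_nonneg_right ?_ ht
  exact (pow_le_pow_left₀ ht hts _).trans (pow_le_pow_right₀ hs (Nat.sub_le_sub_right (by omega) 1))

theorem expBound_mul_pow_le {k : ℕ} (hk : k ≠ 0) {s r : ℝ} (h0 : 0 ≤ s) (hs : s ≤ r)
    (hr : r ≤ periodRadius F) : expBound F k * s ^ q ^ k ≤ contraction F r * s := by
  have hq := one_lt_card (F := F)
  have hq0 := card_pos (F := F)
  set t := s / q with ht
  have ht0 : 0 ≤ t := by positivity
  have h1 : 1 ≤ max 1 (r / q) := le_max_left _ _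
  have hrhs : contraction F r * s = max 1 (r / q) ^ (q ^ 2 - 1) * t := by
    rw [contraction, ht]; field_simp
  rw [hrhs, expBound_mul_pow]
  by_cases hk2 : k ≤ 2
  · rw [show (k + 1) / 2 = 1 by omega, pow_one, ← div_eq_mul_inv, ← ht]
    exact pow_le_pow_sub_one_mul ht0
      ((div_le_div_of_nonneg_right hs hq0.le).trans (le_max_right _ _)) h1 (card_pow_ne_zero k)
      (Nat.pow_le_pow_right Fintype.card_pos hk2)
  · have htq : t / q ≤ 1 := by
      rw [div_le_one hq0, ht, div_le_iff₀' hq0]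
      exact (hs.trans hr).trans (mul_le_mul_of_nonneg_left torsionRadius_le_card hq0.le)
    have hst : s * (q : ℝ)⁻¹ ^ ((k + 1) / 2) ≤ t / q := by
      rw [ht, div_div, ← sq, div_eq_mul_inv, ← inv_pow]
      exact mul_le_mul_of_nonneg_left (pow_le_pow_of_le_one (by positivity)
        (inv_le_one_of_one_le₀ hq.le) (by omega)) h0
    calc _ ≤ (t / q) ^ q ^ k := pow_le_pow_left₀ (by positivity) hst _
      _ ≤ t / q := pow_le_of_le_one (by positivity) htq (card_pow_ne_zero k)
      _ ≤ t := div_le_self ht0 hq.le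
      _ ≤ _ := le_mul_of_one_le_left ht0 (one_le_pow₀ h1)

theorem tendsto_expBound_mul_pow {r : ℝ} (hr : 0 ≤ r) :
    Tendsto (fun k => expBound F k * r ^ q ^ k) atTop (𝓝 0) := by
  have hbase : Tendsto (fun k : ℕ => r * (q : ℝ)⁻¹ ^ ((k + 1) / 2)) atTop (𝓝 (r * 0)) := by
    refine ((tendsto_pow_atTop_nhds_zero_of_lt_one (by positivity)
      (inv_lt_one_of_one_lt₀ one_lt_card)).comp ?_).const_mul r
    exact (Nat.tendsto_div_const_atTop two_ne_zero).comp (tendsto_add_atTop_nat 1)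
  rw [mul_zero] at hbase
  have hle : ∀ᶠ k : ℕ in atTop, expBound F k * r ^ q ^ k ≤ (1 / 2 : ℝ) ^ k := by
    filter_upwards [hbase.eventually (gt_mem_nhds one_half_pos)] with k hk
    rw [expBound_mul_pow]
    refine (pow_le_pow_left₀ (by positivity) hk.le _).trans ?_
    exact pow_le_pow_of_le_one (by norm_num) (by norm_num) (Nat.lt_pow_self Fintype.one_lt_card).le
  exact squeeze_zero' (Eventually.of_forall fun k => mul_nonneg (expBound_nonneg k) (by positivity))
    hle (tendsto_pow_atTop_nhds_zero_of_lt_one (by norm_num) (by norm_num))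

end Radii

/-! ### The exponential series -/

section NearIdentity

variable {E : Type*} [NormedAddCommGroup E] [IsUltrametricDist E]

theorem norm_add_le_of_norm_le {x y : E} {r : ℝ} (hx : ‖x‖ ≤ r) (hy : ‖y‖ ≤ r) : ‖x + y‖ ≤ r :=
  (IsUltrametricDist.norm_add_le_max x y).trans (max_le hx hy)

theorem norm_sub_le_of_norm_le {x y : E} {r : ℝ} (hx : ‖x‖ ≤ r) (hy : ‖y‖ ≤ r) : ‖x - y‖ ≤ r := by
  rw [sub_eq_add_neg]
  exact norm_add_le_of_norm_le hx ((norm_neg y).trans_le hy)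

theorem norm_eq_of_norm_sub_lt {x y : E} (h : ‖y - x‖ < ‖x‖) : ‖y‖ = ‖x‖ := by
  rw [← sub_add_cancel y x, IsUltrametricDist.norm_add_eq_max_of_norm_ne_norm h.ne,
    max_eq_right h.le]

theorem norm_eq_of_norm_sub_le_mul {x y : E} {c : ℝ} (hc : c < 1) (h : ‖y - x‖ ≤ c * ‖x‖) :
    ‖y‖ = ‖x‖ := by
  rcases eq_or_ne x 0 with rfl | hx
  · simpa using h
  · exact norm_eq_of_norm_sub_lt (h.trans_lt (mul_lt_of_lt_one_left (norm_pos_iff.2 hx) hc))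

theorem exists_eq_of_norm_map_sub_le_mul [CompleteSpace E] (f : E →+ E) {c : ℝ} (hc0 : 0 ≤ c)
    (hc : c < 1) {x : E} (hf : ∀ z, ‖z‖ ≤ ‖x‖ → ‖f z - z‖ ≤ c * ‖z‖) :
    ∃ z, f z = x ∧ ‖z‖ = ‖x‖ := by
  let B : Set E := Metric.closedBall 0 ‖x‖
  have memB {z : E} : z ∈ B ↔ ‖z‖ ≤ ‖x‖ := mem_closedBall_zero_iff
  have hmaps : Set.MapsTo (fun z => x - (f z - z)) B B := fun z hz =>
    memB.2 (norm_sub_le_of_norm_le le_rfl ((hf z (memB.1 hz)).trans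
      ((mul_le_of_le_one_left (norm_nonneg z) hc.le).trans (memB.1 hz))))
  have hcontr : ContractingWith ⟨c, hc0⟩ (hmaps.restrict _ B B) := by
    refine ⟨by exact_mod_cast hc, LipschitzWith.of_dist_le_mul fun z w => ?_⟩
    simp only [Subtype.dist_eq, dist_eq_norm, Set.MapsTo.val_restrict_apply]
    rw [show x - (f z - z) - (x - (f w - w)) = -(f (z - w) - (z - w : E)) by rw [map_sub]; abel,
      norm_neg]
    exact hf _ (norm_sub_le_of_norm_le (memB.1 z.2) (memB.1 w.2))
  obtain ⟨z, hzB, hz, -⟩ := ContractingWith.exists_fixedPoint' Metric.isClosed_closedBall.isComplete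
    hmaps hcontr (memB.2 (norm_zero.trans_le (norm_nonneg x))) (edist_ne_top _ _)
  have hfz : f z = x := by
    rw [Function.IsFixedPt, sub_eq_iff_eq_add, add_sub_cancel] at hz
    exact hz.symm
  exact ⟨z, hfz, by rw [← hfz, norm_eq_of_norm_sub_le_mul hc (hf z (memB.1 hzB))]⟩

end NearIdentity

section FrobeniusSeries

variable {n : ℕ}

theorem mulVec_pow_card_pow {m n : Type*} [Fintype n] (M : Matrix m n (CInf F)) (v : n → CInf F)
    (k : ℕ) : (M *ᵥ v) ^ q ^ k = M.map (CInf.frob k) *ᵥ v ^ q ^ k :=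
  funext fun i => RingHom.map_mulVec (CInf.frob k) M v i

/-- The term `Cₖ z^(k)` of the series `∑ₖ Cₖ z^(k)`. -/
def seriesTerm (C : ℕ → Matrix (Fin n) (Fin n) (CInf F)) (z : Fin n → CInf F) (k : ℕ) :
    Fin n → CInf F :=
  C k *ᵥ z ^ q ^ k

variable {C : ℕ → Matrix (Fin n) (Fin n) (CInf F)}

theorem seriesTerm_zero (hC : C 0 = 1) (z : Fin n → CInf F) : seriesTerm C z 0 = z := by
  rw [seriesTerm, hC, Matrix.one_mulVec, pow_zero, pow_one]

theorem seriesTerm_add (z w : Fin n → CInf F) (k : ℕ) :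
    seriesTerm C (z + w) k = seriesTerm C z k + seriesTerm C w k := by
  simp only [seriesTerm, add_pow_card_pow, Matrix.mulVec_add]

theorem seriesTerm_smul (a : CInf F) (z : Fin n → CInf F) (k : ℕ) :
    seriesTerm C (a • z) k = a ^ q ^ k • seriesTerm C z k := by
  rw [seriesTerm, smul_pow, Matrix.mulVec_smul, seriesTerm]

theorem norm_seriesTerm_le (z : Fin n → CInf F) (k : ℕ) :
    ‖seriesTerm C z k‖ ≤ ‖C k‖ * ‖z‖ ^ q ^ k :=
  (norm_mulVec_le _ _).trans_eq (by rw [pi_norm_pow _ (card_pow_ne_zero k)])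

theorem norm_sub_le_of_hasSum_seriesTerm (hC : C 0 = 1) {z x : Fin n → CInf F}
    (hx : HasSum (seriesTerm C z) x) {b : ℝ} (hb : ∀ k, ‖seriesTerm C z (k + 1)‖ ≤ b) :
    ‖x - z‖ ≤ b := by
  have htail := (hasSum_nat_add_iff' 1).2 hx
  rw [Finset.sum_range_one, seriesTerm_zero hC] at htail
  rw [← htail.tsum_eq]
  exact IsUltrametricDist.norm_tsum_le_of_forall_le_of_nonneg ((norm_nonneg _).trans (hb 0)) hb

end FrobeniusSeries

namespace Motive

variable {n : ℕ}

theorem norm_theta_pow_sub_theta {k : ℕ} (hk : k ≠ 0) :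
    ‖CInf.theta F ^ q ^ k - CInf.theta F‖ = (q : ℝ) ^ q ^ k := by
  have hlt : ‖CInf.theta F‖ < ‖CInf.theta F ^ q ^ k‖ := by
    rw [norm_pow, CInf.norm_theta]
    exact lt_self_pow₀ one_lt_card (Nat.one_lt_pow hk Fintype.one_lt_card)
  rw [norm_eq_of_norm_sub_lt (x := CInf.theta F ^ q ^ k), norm_pow, CInf.norm_theta]
  rwa [sub_sub_cancel_left, norm_neg]

theorem theta_pow_sub_theta_ne_zero {k : ℕ} (hk : k ≠ 0) :
    CInf.theta F ^ q ^ k - CInf.theta F ≠ 0 := by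
  rw [← norm_pos_iff, norm_theta_pow_sub_theta hk]
  exact pow_pos card_pos _

/-- The coefficients of the exponential of `M(A)`, determined by `Exp (θ z) = T (Exp z)`. -/
def expCoeff (A : Matrix (Fin n) (Fin n) (CInf F)) : ℕ → Matrix (Fin n) (Fin n) (CInf F)
  | 0 => 1
  | 1 => (CInf.theta F ^ q ^ 1 - CInf.theta F)⁻¹ • A
  | k + 2 => (CInf.theta F ^ q ^ (k + 2) - CInf.theta F)⁻¹ •
      (A * (expCoeff A (k + 1)).map (CInf.frob 1) + (expCoeff A k).map (CInf.frob 2))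

variable {A B : Matrix (Fin n) (Fin n) (CInf F)}

theorem norm_inv_theta_smul_add_le {k : ℕ} {M N : Matrix (Fin n) (Fin n) (CInf F)} {ε : ℝ}
    (hε : 0 ≤ ε) (hM : ‖M‖ ≤ ε * expBound F (k + 1) ^ q) (hN : ‖N‖ ≤ ε * expBound F k ^ q ^ 2) :
    ‖(CInf.theta F ^ q ^ (k + 2) - CInf.theta F)⁻¹ • (M + N)‖ ≤ ε * expBound F (k + 2) := by
  have hd : 0 ≤ ((q : ℝ) ^ q ^ (k + 2))⁻¹ := by positivity
  rw [norm_smul, norm_inv, norm_theta_pow_sub_theta (by omega), ← smul_eq_mul]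
  refine (smul_le_smul_of_nonneg_left (IsUltrametricDist.norm_add_le_max M N) hd).trans ?_
  rw [smul_eq_mul, mul_max_of_nonneg _ _ hd]
  refine max_le ((mul_le_mul_of_nonneg_left hM hd).trans ?_)
    ((mul_le_mul_of_nonneg_left hN hd).trans ?_)
  · rw [mul_left_comm]
    exact mul_le_mul_of_nonneg_left inv_mul_expBound_succ_pow_le hε
  · rw [mul_left_comm]
    exact mul_le_mul_of_nonneg_left inv_mul_expBound_pow_le hε

theorem norm_map_frob_le_of_le {M : Matrix (Fin n) (Fin n) (CInf F)} {ε b : ℝ} (hε0 : 0 ≤ ε)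
    (hε : ε ≤ 1) (hb : 0 ≤ b) (hM : ‖M‖ ≤ ε * b) (k : ℕ) :
    ‖M.map (CInf.frob k)‖ ≤ ε * b ^ q ^ k := by
  refine (CInf.norm_map_frob_le M k).trans ((pow_le_pow_left₀ (norm_nonneg _) hM _).trans ?_)
  rw [mul_pow]
  exact mul_le_mul_of_nonneg_right (pow_le_of_le_one hε0 hε (card_pow_ne_zero k)) (by positivity)

theorem norm_expCoeff_le (hA : ‖A‖ ≤ 1) (k : ℕ) : ‖expCoeff A k‖ ≤ expBound F k := by
  have hE (k : ℕ) := expBound_nonneg (F := F) k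
  induction k using Nat.twoStepInduction with
  | zero =>
    refine (Matrix.norm_le_iff (hE 0)).2 fun i j => ?_
    rcases eq_or_ne i j with rfl | hij <;> simp [expCoeff, expBound, *]
  | one =>
    rw [expCoeff, norm_smul, norm_inv, norm_theta_pow_sub_theta one_ne_zero, expBound]
    simpa using mul_le_of_le_one_right (by positivity) hA
  | more k ih ih' =>
    rw [← one_mul (expBound F (k + 2)), expCoeff]
    refine norm_inv_theta_smul_add_le zero_le_one ?_
      (norm_map_frob_le_of_le zero_le_one le_rfl (hE k) (by simpa using ih) 2)
    have hC := norm_map_frob_le_of_le zero_le_one le_rfl (hE (k + 1)) (by simpa using ih') 1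
    rw [one_mul, pow_one] at hC
    exact (norm_matrix_mul_le _ _).trans (mul_le_mul hA hC (norm_nonneg _) zero_le_one)

theorem norm_expCoeff_sub_le (hA : ‖A‖ ≤ 1) (hB : ‖B‖ ≤ 1) (k : ℕ) :
    ‖expCoeff A k - expCoeff B k‖ ≤ ‖A - B‖ * expBound F k := by
  have hε : ‖A - B‖ ≤ 1 := norm_sub_le_of_norm_le hA hB
  have hE (k : ℕ) := expBound_nonneg (F := F) k
  induction k using Nat.twoStepInduction with
  | zero => simpa [expCoeff] using mul_nonneg (norm_nonneg _) (hE 0)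
  | one =>
    rw [expCoeff, expCoeff, ← smul_sub, norm_smul, norm_inv, norm_theta_pow_sub_theta one_ne_zero,
      expBound, mul_comm]
    simp
  | more k ih ih' =>
    let D (j k : ℕ) := (expCoeff A k - expCoeff B k).map (CInf.frob j)
    have hsub : expCoeff A (k + 2) - expCoeff B (k + 2)
        = (CInf.theta F ^ q ^ (k + 2) - CInf.theta F)⁻¹ •
          ((A - B) * (expCoeff A (k + 1)).map (CInf.frob 1) + B * D 1 (k + 1) + D 2 k) := by
      simp only [expCoeff, D, Matrix.map_sub _ (map_sub (CInf.frob (F := F) _)), ← smul_sub]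
      congr 1
      noncomm_ring
    rw [hsub]
    refine norm_inv_theta_smul_add_le (norm_nonneg _) (norm_add_le_of_norm_le ?_ ?_)
      (norm_map_frob_le_of_le (norm_nonneg _) hε (hE k) ih 2)
    · refine (norm_matrix_mul_le _ _).trans (mul_le_mul_of_nonneg_left ?_ (norm_nonneg _))
      have hC := CInf.norm_map_frob_le (expCoeff A (k + 1)) 1
      rw [pow_one] at hC
      exact hC.trans (pow_le_pow_left₀ (norm_nonneg _) (norm_expCoeff_le hA _) _)
    · have hD := norm_map_frob_le_of_le (norm_nonneg _) hε (hE (k + 1)) ih' 1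
      rw [pow_one] at hD
      exact (norm_matrix_mul_le _ _).trans
        ((mul_le_of_le_one_left (norm_nonneg _) hB).trans hD)

variable (A) in
/-- The exponential of `M(A)` in coordinates. -/
def expMap (z : Fin n → CInf F) : Fin n → CInf F := ∑' k, seriesTerm (expCoeff A) z k

theorem norm_seriesTerm_expCoeff_le (hA : ‖A‖ ≤ 1) (z : Fin n → CInf F) (k : ℕ) :
    ‖seriesTerm (expCoeff A) z k‖ ≤ expBound F k * ‖z‖ ^ q ^ k :=
  (norm_seriesTerm_le z k).trans
    (mul_le_mul_of_nonneg_right (norm_expCoeff_le hA k) (by positivity))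

theorem hasSum_expMap (hA : ‖A‖ ≤ 1) (z : Fin n → CInf F) :
    HasSum (seriesTerm (expCoeff A) z) (expMap A z) := by
  refine Summable.hasSum (NonarchimedeanAddGroup.summable_of_tendsto_cofinite_zero ?_)
  rw [Nat.cofinite_eq_atTop]
  exact squeeze_zero_norm (norm_seriesTerm_expCoeff_le hA z)
    (tendsto_expBound_mul_pow (norm_nonneg z))

/-- The exponential of `M(A)` as an additive map. -/
def expHom (hA : ‖A‖ ≤ 1) : (Fin n → CInf F) →+ (Fin n → CInf F) :=
  AddMonoidHom.mk' (expMap A) fun z w => by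
    refine (hasSum_expMap hA (z + w)).unique ?_
    rw [funext (seriesTerm_add z w)]
    exact (hasSum_expMap hA z).add (hasSum_expMap hA w)

theorem expMap_zero (hA : ‖A‖ ≤ 1) : expMap A 0 = 0 := map_zero (expHom hA)

theorem expMap_add (hA : ‖A‖ ≤ 1) (z w : Fin n → CInf F) :
    expMap A (z + w) = expMap A z + expMap A w := map_add (expHom hA) z w

theorem expMap_sub (hA : ‖A‖ ≤ 1) (z w : Fin n → CInf F) :
    expMap A (z - w) = expMap A z - expMap A w := map_sub (expHom hA) z w

theorem theta_smul_seriesTerm_expCoeff_one (z : Fin n → CInf F) :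
    (CInf.theta F ^ q ^ 1 - CInf.theta F) • seriesTerm (expCoeff A) z 1
      = A *ᵥ z ^ q ^ 1 := by
  rw [seriesTerm, expCoeff, Matrix.smul_mulVec,
    smul_inv_smul₀ (theta_pow_sub_theta_ne_zero one_ne_zero)]

theorem theta_smul_seriesTerm_expCoeff_add_two (z : Fin n → CInf F) (k : ℕ) :
    (CInf.theta F ^ q ^ (k + 2) - CInf.theta F) • seriesTerm (expCoeff A) z (k + 2)
      = A *ᵥ seriesTerm (expCoeff A) z (k + 1) ^ q ^ 1 + seriesTerm (expCoeff A) z k ^ q ^ 2 := by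
  rw [seriesTerm, expCoeff, Matrix.smul_mulVec,
    smul_inv_smul₀ (theta_pow_sub_theta_ne_zero (by omega)), Matrix.add_mulVec,
    ← Matrix.mulVec_mulVec]
  simp only [seriesTerm, mulVec_pow_card_pow, ← pow_mul, ← pow_add]

theorem expMap_theta_smul (hA : ‖A‖ ≤ 1) (z : Fin n → CInf F) :
    expMap A (CInf.theta F • z) = tAct A (expMap A z) := by
  let t := seriesTerm (expCoeff A) z
  have ht : HasSum t (expMap A z) := hasSum_expMap hA z
  let φ : (Fin n → CInf F) →+ (Fin n → CInf F) :=
    AddMonoidHom.mk' (fun x => A *ᵥ x ^ q ^ 1) fun x y => by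
      simp only [add_pow_card_pow, Matrix.mulVec_add]
  let ψ : (Fin n → CInf F) →+ (Fin n → CInf F) :=
    AddMonoidHom.mk' (fun x => x ^ q ^ 2) fun x y => add_pow_card_pow x y 2
  have hφ : HasSum (fun k => φ (t k)) (φ (expMap A z)) :=
    ht.map φ (Continuous.matrix_mulVec continuous_const (continuous_pow _))
  have hψ : HasSum (fun k => ψ (t k)) (ψ (expMap A z)) := ht.map ψ (continuous_pow _)
  have hdiff : HasSum (fun k => (CInf.theta F ^ q ^ k - CInf.theta F) • t k)
      (φ (expMap A z) + ψ (expMap A z)) := by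
    have htail := ((hasSum_nat_add_iff' 1).2 hφ).add hψ
    rw [← hasSum_nat_add_iff' 2]
    convert htail using 1
    · exact funext fun k => theta_smul_seriesTerm_expCoeff_add_two z k
    · have h0 : (CInf.theta F ^ q ^ 0 - CInf.theta F) • t 0 = 0 := by simp
      have h1 : (CInf.theta F ^ q ^ 1 - CInf.theta F) • t 1 = φ (t 0) := by
        rw [show t 0 = z from seriesTerm_zero rfl z]
        exact theta_smul_seriesTerm_expCoeff_one z
      rw [Finset.sum_range_succ, Finset.sum_range_one, Finset.sum_range_one, h0, h1]
      abel
  refine (hasSum_expMap hA (CInf.theta F • z)).unique ?_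
  rw [tAct_apply, ← pow_one q, add_assoc, pow_one q]
  convert (ht.const_smul (CInf.theta F)).add hdiff using 1
  · funext k
    rw [seriesTerm_smul, sub_smul, add_sub_cancel]
  · simp [φ, ψ]

theorem norm_expMap_sub_le (hA : ‖A‖ ≤ 1) {z : Fin n → CInf F} {r : ℝ} (hz : ‖z‖ ≤ r)
    (hr : r ≤ periodRadius F) : ‖expMap A z - z‖ ≤ contraction F r * ‖z‖ :=
  norm_sub_le_of_hasSum_seriesTerm rfl (hasSum_expMap hA z) fun k =>
    (norm_seriesTerm_expCoeff_le hA z _).trans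
      (expBound_mul_pow_le k.succ_ne_zero (norm_nonneg z) hz hr)

theorem norm_expMap (hA : ‖A‖ ≤ 1) {z : Fin n → CInf F} (hz : ‖z‖ < periodRadius F) :
    ‖expMap A z‖ = ‖z‖ :=
  norm_eq_of_norm_sub_le_mul (contraction_lt_one hz) (norm_expMap_sub_le hA le_rfl hz.le)

theorem periodRadius_le_norm (hA : ‖A‖ ≤ 1) {z : Fin n → CInf F} (hz : expMap A z = 0)
    (h0 : z ≠ 0) : periodRadius F ≤ ‖z‖ := by
  by_contra! h
  rw [← norm_ne_zero_iff, ← norm_expMap hA h, hz, norm_zero] at h0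
  exact h0 rfl

theorem exists_expMap_eq (hA : ‖A‖ ≤ 1) {x : Fin n → CInf F} (hx : ‖x‖ < periodRadius F) :
    ∃ z, expMap A z = x ∧ ‖z‖ = ‖x‖ :=
  exists_eq_of_norm_map_sub_le_mul (expHom hA) (contraction_nonneg ‖x‖) (contraction_lt_one hx)
    fun _ hz => norm_expMap_sub_le hA hz hx.le

theorem norm_expMap_sub_expMap_le (hA : ‖A‖ ≤ 1) (hB : ‖B‖ ≤ 1) {z : Fin n → CInf F}
    (hz : ‖z‖ ≤ periodRadius F) : ‖expMap A z - expMap B z‖ ≤ ‖A - B‖ * ‖z‖ := by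
  rw [← ((hasSum_expMap hA z).sub (hasSum_expMap hB z)).tsum_eq]
  refine IsUltrametricDist.norm_tsum_le_of_forall_le_of_nonneg (by positivity) fun k => ?_
  have hk : seriesTerm (expCoeff A) z k - seriesTerm (expCoeff B) z k
      = seriesTerm (expCoeff A - expCoeff B) z k := (Matrix.sub_mulVec _ _ _).symm
  rw [hk]
  rcases eq_or_ne k 0 with rfl | hk0
  · rw [seriesTerm, show (expCoeff A - expCoeff B) 0 = 0 from sub_self 1, Matrix.zero_mulVec,
      norm_zero]
    positivity
  · calc ‖seriesTerm (expCoeff A - expCoeff B) z k‖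
      _ ≤ ‖A - B‖ * expBound F k * ‖z‖ ^ q ^ k := (norm_seriesTerm_le z k).trans
          (mul_le_mul_of_nonneg_right (norm_expCoeff_sub_le hA hB k) (by positivity))
      _ ≤ ‖A - B‖ * ‖z‖ := by
          rw [mul_assoc]
          refine mul_le_mul_of_nonneg_left ?_ (norm_nonneg _)
          exact (expBound_mul_pow_le hk0 (norm_nonneg z) hz le_rfl).trans
            (mul_le_of_le_one_left (norm_nonneg z) (contraction_le_one le_rfl))

end Motive

theorem forall_of_forall_smul {𝕜 E : Type*} [NormedField 𝕜] [SeminormedAddCommGroup E]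
    [NormedSpace 𝕜 E] {c : 𝕜} (hc : 1 < ‖c‖) {p : E → Prop} {δ : ℝ} (hδ : 0 < δ)
    (hsmall : ∀ z, ‖z‖ ≤ δ → p z) (hsmul : ∀ z, p z → p (c • z)) (z : E) : p z := by
  have hpow (N : ℕ) (z : E) (hz : p z) : p (c ^ N • z) := by
    induction N with
    | zero => simpa using hz
    | succ N ih => simpa [pow_succ', mul_smul] using hsmul _ ih
  obtain ⟨N, hN⟩ := pow_unbounded_of_one_lt (‖z‖ / δ) hc
  have hcN : 0 < ‖c ^ N‖ := by rw [norm_pow]; exact pow_pos (zero_lt_one.trans hc) N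
  rw [← norm_pow, div_lt_iff₀ hδ] at hN
  rw [← smul_inv_smul₀ (norm_pos_iff.1 hcN) z]
  refine hpow N _ (hsmall _ ?_)
  rw [norm_smul, norm_inv, inv_mul_le_iff₀ hcN]
  exact hN.le

theorem exists_norm_le_of_summable_seriesTerm {n : ℕ} {C : ℕ → Matrix (Fin n) (Fin n) (CInf F)}
    (hC : ∀ z, Summable (seriesTerm C z)) : ∃ b, ∀ k, ‖C k‖ ≤ b := by
  have hlim : Tendsto C atTop (𝓝 0) := by
    refine tendsto_pi_nhds.2 fun i => tendsto_pi_nhds.2 fun j => ?_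
    have hcol (k : ℕ) : seriesTerm C (Pi.single j 1) k i = C k i j := by
      have hsingle : (Pi.single j 1 : Fin n → CInf F) ^ q ^ k = Pi.single j 1 := by
        ext l
        simp [Pi.single_apply, ite_pow]
      rw [seriesTerm, hsingle, Matrix.mulVec_single_one, Matrix.col_apply]
    simpa only [hcol] using! tendsto_pi_nhds.1 (hC (Pi.single j 1)).tendsto_atTop_zero i
  obtain ⟨b, hb⟩ := (Metric.isBounded_range_of_tendsto _ hlim).exists_norm_le
  exact ⟨b, fun k => hb _ ⟨k, rfl⟩⟩

namespace Motive

variable {n : ℕ} {A : Matrix (Fin n) (Fin n) (CInf F)}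

theorem one_lt_norm_theta : 1 < ‖CInf.theta F‖ := by
  rw [CInf.norm_theta]
  exact one_lt_card

theorem norm_theta_smul (z : Fin n → CInf F) : ‖CInf.theta F • z‖ = q * ‖z‖ := by
  rw [norm_smul, CInf.norm_theta]

theorem norm_mulVec_pow_card_le (hA : ‖A‖ ≤ 1) (x : Fin n → CInf F) : ‖A *ᵥ x ^ q‖ ≤ ‖x‖ ^ q := by
  rw [← pi_norm_pow x Fintype.card_ne_zero]
  exact (norm_mulVec_le _ _).trans (mul_le_of_le_one_left (norm_nonneg _) hA)

theorem norm_tAct_le (hA : ‖A‖ ≤ 1) {x : Fin n → CInf F} (hx : ‖x‖ ≤ 1) :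
    ‖tAct A x‖ ≤ q * ‖x‖ := by
  have hpow {m : ℕ} (hm : m ≠ 0) : ‖x‖ ^ m ≤ q * ‖x‖ :=
    (pow_le_of_le_one (norm_nonneg x) hx hm).trans
      (le_mul_of_one_le_left (norm_nonneg x) one_lt_card.le)
  rw [tAct_apply]
  refine norm_add_le_of_norm_le (norm_add_le_of_norm_le (norm_theta_smul x).le ?_) ?_
  · exact (norm_mulVec_pow_card_le hA x).trans (hpow Fintype.card_ne_zero)
  · exact (pi_norm_pow x (card_pow_ne_zero 2)).trans_le (hpow (card_pow_ne_zero 2))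

theorem norm_tAct_eq (hA : ‖A‖ ≤ 1) {x : Fin n → CInf F} (hx : torsionRadius F < ‖x‖) :
    ‖tAct A x‖ = ‖x‖ ^ q ^ 2 := by
  have hpow : ‖x ^ q ^ 2‖ = ‖x‖ ^ q ^ 2 := pi_norm_pow x (card_pow_ne_zero 2)
  rw [tAct_apply, ← hpow]
  refine norm_eq_of_norm_sub_lt ?_
  rw [add_sub_cancel_right, hpow]
  refine (IsUltrametricDist.norm_add_le_max _ _).trans_lt (max_lt ?_ ?_)
  · rw [norm_theta_smul, ← Nat.sub_one_add_one (card_pow_ne_zero (F := F) 2), pow_succ,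
      ← torsionRadius_pow]
    have h0 := torsionRadius_pos (F := F)
    exact mul_lt_mul_of_pos_right (pow_lt_pow_left₀ hx h0.le card_sq_sub_one_ne_zero) (h0.trans hx)
  · exact (norm_mulVec_pow_card_le hA x).trans_lt (pow_lt_pow_right₀ (one_lt_torsionRadius.trans hx)
      (lt_self_pow₀ Fintype.one_lt_card one_lt_two))

theorem norm_le_torsionRadius (hA : ‖A‖ ≤ 1) {x : Fin n → CInf F}
    (hx : ‖tAct A x‖ ≤ periodRadius F) : ‖x‖ ≤ torsionRadius F := by
  by_contra! h
  refine hx.not_gt ?_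
  calc periodRadius F = torsionRadius F ^ q ^ 2 := by
        rw [periodRadius, ← Nat.sub_one_add_one (card_pow_ne_zero (F := F) 2), pow_succ,
          torsionRadius_pow]
    _ < ‖x‖ ^ q ^ 2 := pow_lt_pow_left₀ h torsionRadius_pos.le (card_pow_ne_zero 2)
    _ = ‖tAct A x‖ := (norm_tAct_eq hA h).symm

/-! ### Uniqueness of the exponential -/

theorem norm_le_div_pow_of_theta_equivariant (hA : ‖A‖ ≤ 1)
    {f : (Fin n → CInf F) → (Fin n → CInf F)} {b δ : ℝ} (hδ : ∀ z, ‖z‖ ≤ δ → ‖f z‖ ≤ 1)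
    (hf : ∀ z, ‖z‖ ≤ δ → ‖f z‖ ≤ b * ‖z‖ ^ 2)
    (hθ : ∀ z, f (CInf.theta F • z) = tAct A (f z)) (N : ℕ) (z : Fin n → CInf F) (hz : ‖z‖ ≤ δ) :
    ‖f z‖ ≤ b * ‖z‖ ^ 2 / q ^ N := by
  induction N generalizing z with
  | zero => simpa using hf z hz
  | succ N ih =>
    have hq := card_pos (F := F)
    obtain ⟨w, rfl⟩ : ∃ w, CInf.theta F • w = z := ⟨_, smul_inv_smul₀ CInf.theta_ne_zero z⟩
    rw [norm_theta_smul] at hz ⊢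
    have hw : ‖w‖ ≤ δ := (le_mul_of_one_le_left (norm_nonneg w) one_lt_card.le).trans hz
    calc ‖f (CInf.theta F • w)‖
      _ ≤ q * ‖f w‖ := by rw [hθ]; exact norm_tAct_le hA (hδ w hw)
      _ ≤ q * (b * ‖w‖ ^ 2 / q ^ N) := mul_le_mul_of_nonneg_left (ih w hw) hq.le
      _ = b * (q * ‖w‖) ^ 2 / q ^ (N + 1) := by field_simp; ring

theorem eq_zero_of_theta_equivariant (hA : ‖A‖ ≤ 1) {f : (Fin n → CInf F) → (Fin n → CInf F)}
    {b : ℝ} (hf : ∀ z, ‖z‖ ≤ 1 → ‖f z‖ ≤ b * ‖z‖ ^ 2)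
    (hθ : ∀ z, f (CInf.theta F • z) = tAct A (f z)) (z : Fin n → CInf F) : f z = 0 := by
  let δ : ℝ := min 1 (max b 1)⁻¹
  have hb : 0 < max b 1 := lt_max_of_lt_right one_pos
  have hδ : ∀ z, ‖z‖ ≤ δ → ‖f z‖ ≤ 1 := fun z hz => by
    have hz1 : ‖z‖ ≤ 1 := hz.trans (min_le_left _ _)
    calc ‖f z‖ ≤ b * ‖z‖ ^ 2 := hf z hz1
      _ ≤ max b 1 * (max b 1)⁻¹ := mul_le_mul (le_max_left _ _)
          ((pow_le_of_le_one (norm_nonneg z) hz1 two_ne_zero).trans (hz.trans (min_le_right _ _)))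
          (by positivity) hb.le
      _ = 1 := mul_inv_cancel₀ hb.ne'
  refine forall_of_forall_smul (p := fun z => f z = 0) (one_lt_norm_theta (F := F))
    (lt_min one_pos (inv_pos.2 hb)) (fun z hz => ?_) (fun z hz => by rw [hθ, hz, map_zero]) z
  have hlim : Tendsto (fun N : ℕ => b * ‖z‖ ^ 2 / (q : ℝ) ^ N) atTop (𝓝 0) :=
    tendsto_const_nhds.div_atTop (tendsto_pow_atTop_atTop_of_one_lt one_lt_card)
  exact norm_le_zero_iff.1 <| ge_of_tendsto' hlim fun N =>
    norm_le_div_pow_of_theta_equivariant hA hδ (fun z hz => hf z (hz.trans (min_le_left _ _))) hθ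
      N z hz

theorem norm_sub_le_mul_norm_sq {C : ℕ → Matrix (Fin n) (Fin n) (CInf F)} (hC0 : C 0 = 1) {b : ℝ}
    (hC : ∀ k, ‖C k‖ ≤ b) {z x : Fin n → CInf F} (hz : ‖z‖ ≤ 1) (hx : HasSum (seriesTerm C z) x) :
    ‖x - z‖ ≤ b * ‖z‖ ^ 2 := by
  refine norm_sub_le_of_hasSum_seriesTerm hC0 hx fun k => (norm_seriesTerm_le z _).trans ?_
  refine mul_le_mul (hC _) (pow_le_pow_of_le_one (norm_nonneg z) hz ?_) (by positivity)
    ((norm_nonneg _).trans (hC 0))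
  exact Fintype.one_lt_card.trans_le (Nat.le_self_pow k.succ_ne_zero _)

theorem eq_expMap_of_theta_equivariant (hA : ‖A‖ ≤ 1) {C : ℕ → Matrix (Fin n) (Fin n) (CInf F)}
    (hC0 : C 0 = 1) {f : (Fin n → CInf F) → (Fin n → CInf F)}
    (hf : ∀ z, HasSum (seriesTerm C z) (f z)) (hθ : ∀ z, f (CInf.theta F • z) = tAct A (f z))
    (z : Fin n → CInf F) : f z = expMap A z := by
  obtain ⟨b, hb⟩ := exists_norm_le_of_summable_seriesTerm fun z => (hf z).summable
  rw [← sub_eq_zero]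
  refine eq_zero_of_theta_equivariant hA (f := fun z => f z - expMap A z) (b := max b 1)
    (fun z hz => ?_) (fun z => ?_) z
  · rw [← sub_sub_sub_cancel_right _ _ z]
    refine norm_sub_le_of_norm_le
      (norm_sub_le_mul_norm_sq hC0 (fun k => (hb k).trans (le_max_left _ _)) hz (hf z))
      (norm_sub_le_mul_norm_sq rfl (fun k => ?_) hz (hasSum_expMap hA z))
    exact (norm_expCoeff_le hA k).trans ((expBound_le_one k).trans (le_max_right _ _))
  · rw [hθ, expMap_theta_smul hA, map_sub]

theorem isExponential_iff (hA : ‖A‖ ≤ 1) {Exp : TLie F (Motive A) → TPoints F (Motive A)} :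
    IsExponential (e A) Exp ↔ ∀ z, tPointsEquiv A (Exp z) = expMap A (tLieEquiv A z) := by
  have hterm (C : ℕ → Matrix (Fin n) (Fin n) (CInf F)) (z : TLie F (Motive A)) :
      HasSum (seriesTerm C (tLieEquiv A z)) (tPointsEquiv A (Exp z)) ↔
        ∀ i, HasSum (fun k => ∑ j, C k i j * (z : Motive A →+ CInf F) (e A j) ^ q ^ k)
          ((Exp z : Motive A →+ CInf F) (e A i)) := by
    simp only [← tLieEquiv_apply, ← tPointsEquiv_apply]
    exact Pi.hasSum
  constructor
  · rintro ⟨⟨C, hC0, hC⟩, hT⟩ z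
    have h := eq_expMap_of_theta_equivariant hA hC0
      (f := fun v => tPointsEquiv A (Exp ((tLieEquiv A).symm v)))
      (fun v => by simpa using (hterm C ((tLieEquiv A).symm v)).2 (hC _)) (fun v => ?_)
      (tLieEquiv A z)
    · simpa using h
    · rw [← tPointsEquiv_T, ← hT]
      congr 2
      rw [Equiv.symm_apply_eq, tLieEquiv_T, Equiv.apply_symm_apply]
  · refine fun h => ⟨⟨expCoeff A, rfl, fun z => ?_⟩, fun z => (tPointsEquiv A).injective ?_⟩
    · rw [← hterm, h]
      exact hasSum_expMap hA _
    · rw [h, tPointsEquiv_T, h, tLieEquiv_T, expMap_theta_smul hA]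

theorem mem_motiveLattice (hA : ‖A‖ ≤ 1) {v : Fin n → CInf F} :
    v ∈ motiveLattice A ↔ expMap A v = 0 := by
  constructor
  · rintro ⟨Exp, hExp, z, hz, h0⟩
    rw [← show tLieEquiv A z = v from funext fun i => (tLieEquiv_apply z i).trans (hz i),
      ← (isExponential_iff hA).1 hExp, h0, tPointsEquiv_zero]
  · intro h
    refine ⟨fun z => (tPointsEquiv A).symm (expMap A (tLieEquiv A z)),
      (isExponential_iff hA).2 fun z => Equiv.apply_symm_apply _ _, (tLieEquiv A).symm v,
      fun i => by rw [← tLieEquiv_apply, Equiv.apply_symm_apply], ?_⟩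
    simp only [Equiv.apply_symm_apply, h, Equiv.symm_apply_eq, tPointsEquiv_zero]

/-! ### The kernel of the exponential -/

theorem expMap_algebraMap_smul (hA : ‖A‖ ≤ 1) (c : F) (z : Fin n → CInf F) :
    expMap A (algebraMap F (CInf F) c • z) = algebraMap F (CInf F) c • expMap A z := by
  refine (hasSum_expMap hA _).unique ?_
  convert (hasSum_expMap hA z).const_smul (algebraMap F (CInf F) c) using 2 with k
  rw [seriesTerm_smul, ← map_pow, FiniteField.pow_card_pow]

/-- The kernel of the exponential of `M(A)`, an `F[θ]`-submodule of `C∞ⁿ`. -/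
def expKer (hA : ‖A‖ ≤ 1) : Submodule (ZInf F) (Fin n → CInf F) where
  __ := (expHom hA).ker
  smul_mem' a v hv := by
    obtain ⟨a, ha⟩ := a
    change expMap A v = 0 at hv
    change expMap A (a • v) = 0
    induction ha using Algebra.adjoin_induction generalizing v with
    | mem a ha => rw [Set.mem_singleton_iff.1 ha, expMap_theta_smul hA, hv, map_zero]
    | algebraMap c => rw [expMap_algebraMap_smul hA, hv, smul_zero]
    | add a b _ _ iha ihb => rw [add_smul, expMap_add hA, iha v hv, ihb v hv, add_zero]
    | mul a b _ _ iha ihb => rw [mul_smul, iha _ (ihb v hv)]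

theorem mem_expKer {hA : ‖A‖ ≤ 1} {v : Fin n → CInf F} : v ∈ expKer hA ↔ expMap A v = 0 := Iff.rfl

theorem motiveLattice_eq_expKer (hA : ‖A‖ ≤ 1) :
    motiveLattice A = (expKer hA : Set (Fin n → CInf F)) :=
  Set.ext fun _ => mem_motiveLattice hA

theorem theta_smul_mem (N : Submodule (ZInf F) (Fin n → CInf F)) {v : Fin n → CInf F}
    (hv : v ∈ N) : CInf.theta F • v ∈ N :=
  N.smul_mem ⟨CInf.theta F, Algebra.subset_adjoin rfl⟩ hv

theorem expKer_le (hA : ‖A‖ ≤ 1) {N : Submodule (ZInf F) (Fin n → CInf F)}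
    (hN : ∀ v ∈ expKer hA, ‖v‖ ≤ periodRadius F → v ∈ N) : expKer hA ≤ N := by
  have hsub : ∀ z w, ‖w‖ < periodRadius F → expMap A z = expMap A w → z - w ∈ N := by
    intro z
    refine forall_of_forall_smul (p := fun z => ∀ w, ‖w‖ < periodRadius F →
      expMap A z = expMap A w → z - w ∈ N) (one_lt_norm_theta (F := F)) (periodRadius_pos (F := F))
      (fun z hz w hw hzw => ?_) (fun z ih w hw hzw => ?_) z
    · refine hN _ ?_ (norm_sub_le_of_norm_le hz hw.le)
      rw [mem_expKer, expMap_sub hA, hzw, sub_self]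
    · rw [expMap_theta_smul hA] at hzw
      have hz : ‖expMap A z‖ ≤ torsionRadius F := norm_le_torsionRadius hA <| by
        rw [hzw, norm_expMap hA hw]
        exact hw.le
      obtain ⟨v, hv, hvz⟩ := exists_expMap_eq hA (hz.trans_lt torsionRadius_lt_periodRadius)
      have hvR : ‖CInf.theta F • v‖ ≤ periodRadius F := by
        rw [norm_theta_smul, hvz]
        exact mul_le_mul_of_nonneg_left hz card_pos.le
      have hzv : z - v ∈ N :=
        ih v (hvz.trans_lt (hz.trans_lt torsionRadius_lt_periodRadius)) hv.symm
      have hvw : CInf.theta F • v - w ∈ N := by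
        refine hN _ ?_ (norm_sub_le_of_norm_le hvR hw.le)
        rw [mem_expKer, expMap_sub hA, expMap_theta_smul hA, hv, hzw, sub_self]
      simpa [smul_sub] using add_mem (theta_smul_mem N hzv) hvw
  intro v hv
  simpa using hsub v 0 (norm_zero.trans_lt periodRadius_pos) (hv.trans (expMap_zero hA).symm)

end Motive

/-! ### Norm-orthogonal bases and Siegel matrices -/

section NormOrthogonal

variable {K E ι : Type*} [NormedField K] [NormedAddCommGroup E] [NormedSpace K E] [Fintype ι]
  {R : ℝ} {b b' : ι → E}

variable (K) in
/-- The family `b` is orthogonal in the nonarchimedean sense, and its vectors have norm `R`. -/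
def IsNormOrthogonal (R : ℝ) (b : ι → E) : Prop := ∀ a : ι → K, ‖∑ i, a i • b i‖ = R * ‖a‖

theorem norm_sum_smul_le [IsUltrametricDist E] (a : ι → K) (d : ι → E) :
    ‖∑ i, a i • d i‖ ≤ ‖a‖ * ‖d‖ := by
  refine IsUltrametricDist.norm_sum_le_of_forall_le_of_nonneg (by positivity) fun i _ => ?_
  rw [norm_smul]
  exact mul_le_mul (norm_le_pi_norm a i) (norm_le_pi_norm d i) (norm_nonneg _) (norm_nonneg _)

namespace IsNormOrthogonal

theorem norm_apply (hb : IsNormOrthogonal K R b) (i : ι) : ‖b i‖ = R := by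
  classical
  have h := hb (Pi.single i 1)
  rw [Pi.norm_single, norm_one, mul_one] at h
  simpa [Pi.single_apply, ite_smul] using h

theorem linearIndependent (hb : IsNormOrthogonal K R b) (hR : R ≠ 0) : LinearIndependent K b := by
  rw [Fintype.linearIndependent_iff]
  intro a ha i
  have h := hb a
  rw [ha, norm_zero, zero_eq_mul, or_iff_right hR, norm_eq_zero] at h
  exact congrFun h i

theorem smul {L : Type*} [NormedField L] [NormedSpace L E] [SMulCommClass K L E]
    (hb : IsNormOrthogonal K R b) (y : L) :
    IsNormOrthogonal K (‖y‖ * R) fun i => y • b i := by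
  intro a
  simp only [smul_comm _ y, ← Finset.smul_sum, norm_smul, hb a, mul_assoc]

theorem of_norm_sub_lt [IsUltrametricDist E] (hb : IsNormOrthogonal K R b)
    (h : ∀ i, ‖b' i - b i‖ < R) : IsNormOrthogonal K R b' := by
  intro a
  rcases eq_or_ne a 0 with rfl | ha
  · simp
  obtain ⟨i, -⟩ := Function.ne_iff.1 ha
  have hR : 0 < R := (norm_nonneg _).trans_lt (h i)
  rw [← hb a]
  refine norm_eq_of_norm_sub_lt ?_
  calc ‖∑ i, a i • b' i - ∑ i, a i • b i‖
    _ = ‖∑ i, a i • (b' - b) i‖ := by simp only [Pi.sub_apply, smul_sub, Finset.sum_sub_distrib]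
    _ ≤ ‖a‖ * ‖b' - b‖ := norm_sum_smul_le _ _
    _ < ‖a‖ * R := mul_lt_mul_of_pos_left ((pi_norm_lt_iff hR).2 h) (norm_pos_iff.2 ha)
    _ = ‖∑ i, a i • b i‖ := by rw [hb a, mul_comm]

end IsNormOrthogonal

theorem isNormOrthogonal_single [DecidableEq ι] :
    IsNormOrthogonal K 1 fun i : ι => (Pi.single i 1 : ι → K) := by
  intro a
  rw [one_mul, ← pi_eq_sum_univ' a]

end NormOrthogonal

section Lattice

variable {n : ℕ}

theorem exists_rInf_smul_eq (a : ZInf F) :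
    ∃ a' : RInf F, algebraMap (RInf F) (CInf F) a' = a ∧ ∀ v : Fin n → CInf F, a • v = a' • v := by
  suffices h : (a : CInf F) ∈ (algebraMap (RInf F) (CInf F)).range by
    obtain ⟨a', ha'⟩ := h
    exact ⟨a', ha', fun v => by rw [Subalgebra.smul_def, ← ha', algebraMap_smul]⟩
  obtain ⟨a, ha⟩ := a
  induction ha using Algebra.adjoin_induction with
  | mem x hx => exact ⟨_, (Set.mem_singleton_iff.1 hx).symm⟩
  | algebraMap c => exact ⟨_, (CInf.algebraMap_eq c).symm⟩
  | add x y _ _ hx hy => exact add_mem hx hy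
  | mul x y _ _ hx hy => exact mul_mem hx hy

theorem linearIndependent_zInf {ι : Type*} [Finite ι] {b : ι → Fin n → CInf F}
    (hb : LinearIndependent (RInf F) b) : LinearIndependent (ZInf F) b := by
  cases nonempty_fintype ι
  rw [Fintype.linearIndependent_iff] at hb ⊢
  intro g hg i
  choose a ha hsmul using fun i => exists_rInf_smul_eq (n := n) (g i)
  simp only [hsmul] at hg
  refine Subtype.ext ?_
  rw [← ha, hb a hg, map_zero, ZeroMemClass.coe_zero]

theorem span_rInf_span_zInf (s : Set (Fin n → CInf F)) :
    Submodule.span (RInf F) (Submodule.span (ZInf F) s : Set (Fin n → CInf F))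
      = Submodule.span (RInf F) s := by
  refine (Submodule.span_mono Submodule.subset_span).antisymm' (Submodule.span_le.2 fun v hv => ?_)
  induction hv using Submodule.span_induction with
  | mem x hx => exact Submodule.subset_span hx
  | zero => exact zero_mem _
  | add x y _ _ hx hy => exact add_mem hx hy
  | smul a x _ hx =>
    obtain ⟨a', -, ha'⟩ := exists_rInf_smul_eq (n := n) a
    rw [ha']
    exact Submodule.smul_mem _ _ hx

theorem span_zInf_range_eq_image {ι : Type*}
    (g : (Fin n → CInf F) ≃ₗ[CInf F] (Fin n → CInf F)) (b : ι → Fin n → CInf F) :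
    (Submodule.span (ZInf F) (Set.range fun i => g (b i)) : Set (Fin n → CInf F))
      = g '' (Submodule.span (ZInf F) (Set.range b) : Set (Fin n → CInf F)) := by
  have h := Submodule.map_span (g.toLinearMap.restrictScalars (ZInf F)) (Set.range b)
  rw [← Set.range_comp] at h
  exact (congrArg SetLike.coe h).symm

theorem span_range_eq_top_of_linearIndependent {b : Fin n → Fin n → CInf F}
    (hb : LinearIndependent (CInf F) b) : Submodule.span (CInf F) (Set.range b) = ⊤ :=
  hb.span_eq_top_of_card_eq_finrank' (by simp)

namespace IsSiegelMatrixOf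

variable {b : Fin n ⊕ Fin n → Fin n → CInf F} {Z : Matrix (Fin n) (Fin n) (CInf F)}

theorem isLattice (h : IsSiegelMatrixOf b Z) (hb : LinearIndependent (RInf F) b) :
    IsLattice (2 * n) (Submodule.span (ZInf F) (Set.range b) : Set (Fin n → CInf F)) where
  free := by
    let σ : Fin (2 * n) ≃ Fin n ⊕ Fin n := (finCongr (two_mul n)).trans finSumFinEquiv.symm
    refine ⟨b ∘ σ, (linearIndependent_zInf hb).comp σ σ.injective, ?_⟩
    rw [σ.surjective.range_comp]
  span_eq_top := by
    rw [eq_top_iff, ← h.2.1, Submodule.span_le]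
    rintro _ ⟨i, rfl⟩
    exact Submodule.subset_span (Submodule.subset_span ⟨Sum.inl i, rfl⟩)
  finrank_envelope := by
    rw [span_rInf_span_zInf, finrank_span_eq_card hb, Fintype.card_sum, Fintype.card_fin, two_mul]

theorem latticeEquiv (h : IsSiegelMatrixOf b Z) :
    LatticeEquiv (Submodule.span (ZInf F) (Set.range b) : Set (Fin n → CInf F))
      (siegelLattice Z) := by
  obtain ⟨hli, hspan, hZ⟩ := h
  let B := Module.Basis.mk hli hspan.ge
  have hinl (i : Fin n) : B.equivFun (b (Sum.inl i)) = Pi.single i 1 := by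
    rw [← Module.Basis.mk_apply hli hspan.ge i, Module.Basis.equivFun_apply, B.repr_self,
      Finsupp.single_eq_pi_single]
  refine ⟨B.equivFun, ?_⟩
  rw [← span_zInf_range_eq_image, siegelLattice]
  congr 3
  funext i
  rcases i with i | i
  · exact hinl i
  · simp only [hZ, map_sum, map_smul, hinl]
    exact (pi_eq_sum_univ' (Z i)).symm

theorem smul (h : IsSiegelMatrixOf b Z) {y : CInf F} (hy : y ≠ 0) :
    IsSiegelMatrixOf (fun i => y • b i) Z := by
  obtain ⟨hli, -, hZ⟩ := h
  have hli' : LinearIndependent (CInf F) fun i => y • b (Sum.inl i) :=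
    hli.units_smul fun _ => Units.mk0 y hy
  refine ⟨hli', span_range_eq_top_of_linearIndependent hli', fun i => ?_⟩
  simp only [hZ, Finset.smul_sum, smul_comm y]

end IsSiegelMatrixOf

theorem isSiegelMatrixOf_siegelBasis (Z : Matrix (Fin n) (Fin n) (CInf F)) :
    IsSiegelMatrixOf (siegelBasis Z) Z := by
  have hli : LinearIndependent (CInf F) fun i => siegelBasis Z (Sum.inl i) :=
    isNormOrthogonal_single.linearIndependent one_ne_zero
  exact ⟨hli, span_range_eq_top_of_linearIndependent hli, fun i => pi_eq_sum_univ' (Z i)⟩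

theorem scaledMotiveLattice_eq_span_iff {A : Matrix (Fin n) (Fin n) (CInf F)} {y : CInf F}
    (hy : y ≠ 0) {ι : Type*} {b : ι → Fin n → CInf F} :
    scaledMotiveLattice y A = (Submodule.span (ZInf F) (Set.range b) : Set (Fin n → CInf F)) ↔
      motiveLattice A = (Submodule.span (ZInf F) (Set.range fun i => y • b i) : Set _) := by
  let g := LinearEquiv.smulOfNeZero (CInf F) (Fin n → CInf F) y hy
  rw [show (fun i => y • b i) = fun i => g (b i) from rfl, span_zInf_range_eq_image]
  exact g.toEquiv.preimage_eq_iff_eq_image _ _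

/-- The matrices at distance less than `1` from `C` for the sup norm. -/
def unitPolydisc (C : Matrix (Fin n) (Fin n) (CInf F)) : Set (Matrix (Fin n) (Fin n) (CInf F)) :=
  Metric.ball C 1

theorem isOpen_unitPolydisc (C : Matrix (Fin n) (Fin n) (CInf F)) : IsOpen (unitPolydisc C) :=
  Metric.isOpen_ball

theorem self_mem_unitPolydisc (C : Matrix (Fin n) (Fin n) (CInf F)) : C ∈ unitPolydisc C :=
  Metric.mem_ball_self one_pos

theorem mem_unitPolydisc {C Z : Matrix (Fin n) (Fin n) (CInf F)} :
    Z ∈ unitPolydisc C ↔ ‖Z - C‖ < 1 := mem_ball_iff_norm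

theorem norm_lt_one_of_mem_unitPolydisc {A : Matrix (Fin n) (Fin n) (CInf F)}
    (hA : A ∈ unitPolydisc 0) : ‖A‖ < 1 :=
  mem_ball_zero_iff.1 hA

/-- The basis `l₀,₁, …, l₀,₂ₙ` of the lattice `L₀ = 𝔏(ω Eₙ)`. -/
abbrev omegaBasis (n : ℕ) (ω : CInf F) : Fin n ⊕ Fin n → Fin n → CInf F :=
  siegelBasis (ω • (1 : Matrix (Fin n) (Fin n) (CInf F)))

theorem omegaBasis_inr (ω : CInf F) (i : Fin n) :
    omegaBasis n ω (Sum.inr i) = ω • omegaBasis n ω (Sum.inl i) :=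
  congrArg (ω • ·) (funext fun _ => Matrix.one_eq_pi_single)

theorem sum_smul_omegaBasis (ω : CInf F) (a : Fin n ⊕ Fin n → CInf F) :
    ∑ i, a i • omegaBasis n ω i = fun j => a (Sum.inl j) + a (Sum.inr j) * ω := by
  have h (c : Fin n → CInf F) : ∑ i, c i • omegaBasis n ω (Sum.inl i) = c :=
    (pi_eq_sum_univ' c).symm
  simp only [Fintype.sum_sum_type, omegaBasis_inr, smul_smul, h]
  rfl

namespace IsQuadraticGenerator

variable {ω : CInf F} {b : Fin n ⊕ Fin n → Fin n → CInf F}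

theorem isNormOrthogonal_omegaBasis (hω : IsQuadraticGenerator ω) :
    IsNormOrthogonal (RInf F) 1 (omegaBasis n ω) := by
  intro a
  have hsum : ∑ i, a i • omegaBasis n ω i = fun j =>
      algebraMap (RInf F) (CInf F) (a (Sum.inl j))
        + algebraMap (RInf F) (CInf F) (a (Sum.inr j)) * ω :=
    (Finset.sum_congr rfl fun i _ => (algebraMap_smul (CInf F) (a i) _).symm).trans
      (sum_smul_omegaBasis ω fun i => algebraMap (RInf F) (CInf F) (a i))
  rw [hsum, one_mul]
  refine le_antisymm ((pi_norm_le_iff_of_nonneg (norm_nonneg _)).2 fun j => ?_)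
    ((pi_norm_le_iff_of_nonneg (norm_nonneg _)).2 fun i => ?_)
  · rw [hω.norm_add_mul]
    exact max_le (norm_le_pi_norm a _) (norm_le_pi_norm a _)
  · refine le_trans ?_ (norm_le_pi_norm _ (i.elim id id))
    rw [hω.norm_add_mul]
    cases i
    exacts [le_max_left _ _, le_max_right _ _]

theorem linearIndependent_of_norm_sub_lt (hω : IsQuadraticGenerator ω)
    (hb : ∀ i, ‖b i - omegaBasis n ω i‖ < 1) : LinearIndependent (RInf F) b :=
  (hω.isNormOrthogonal_omegaBasis.of_norm_sub_lt hb).linearIndependent one_ne_zero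

theorem norm_inr_sub_smul_inl_lt (hω : IsQuadraticGenerator ω)
    (hb : ∀ i, ‖b i - omegaBasis n ω i‖ < 1) (i : Fin n) :
    ‖b (Sum.inr i) - ω • b (Sum.inl i)‖ < 1 := by
  have hsplit : b (Sum.inr i) - ω • b (Sum.inl i)
      = (b (Sum.inr i) - omegaBasis n ω (Sum.inr i))
        - ω • (b (Sum.inl i) - omegaBasis n ω (Sum.inl i)) := by
    rw [omegaBasis_inr, smul_sub, sub_sub_sub_cancel_right]
  rw [hsplit, sub_eq_add_neg]
  refine (IsUltrametricDist.norm_add_le_max _ _).trans_lt (max_lt (hb _) ?_)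
  rw [norm_neg, norm_smul, hω.norm_eq_one, one_mul]
  exact hb _

theorem exists_isSiegelMatrixOf (hω : IsQuadraticGenerator ω)
    (hb : ∀ i, ‖b i - omegaBasis n ω i‖ < 1) :
    ∃ Z : unitPolydisc (ω • (1 : Matrix (Fin n) (Fin n) (CInf F))), IsSiegelMatrixOf b Z.1 := by
  have horth : IsNormOrthogonal (CInf F) 1 fun i => b (Sum.inl i) :=
    isNormOrthogonal_single.of_norm_sub_lt fun i => hb (Sum.inl i)
  have hli := horth.linearIndependent one_ne_zero
  have hex (i : Fin n) : ∃ c : Fin n → CInf F, ∑ j, c j • b (Sum.inl j) = b (Sum.inr i) := by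
    rw [← Submodule.mem_span_range_iff_exists_fun, span_range_eq_top_of_linearIndependent hli]
    trivial
  choose Z hZ using hex
  refine ⟨⟨Z, mem_unitPolydisc.2 ((pi_norm_lt_iff one_pos).2 fun i => ?_)⟩, hli,
    span_range_eq_top_of_linearIndependent hli, fun i => (hZ i).symm⟩
  let row : Fin n → CInf F := Z i - ω • Pi.single i 1
  have hrow : ∑ j, row j • b (Sum.inl j) = b (Sum.inr i) - ω • b (Sum.inl i) := by
    simp [row, sub_smul, hZ, Pi.single_apply, ite_smul]
  calc ‖(Matrix.of Z - ω • (1 : Matrix (Fin n) (Fin n) (CInf F))) i‖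
    _ = ‖row‖ := congrArg (‖Z i - ·‖) (omegaBasis_inr ω i)
    _ = ‖b (Sum.inr i) - ω • b (Sum.inl i)‖ := by rw [← hrow, horth, one_mul]
    _ < 1 := hω.norm_inr_sub_smul_inl_lt hb i

theorem unitPolydisc_subset_siegelMatrices (hω : IsQuadraticGenerator ω) :
    unitPolydisc (ω • (1 : Matrix (Fin n) (Fin n) (CInf F))) ⊆ siegelMatrices F n := by
  intro Z hZ
  have hnear (i : Fin n ⊕ Fin n) : ‖siegelBasis Z i - omegaBasis n ω i‖ < 1 := by
    rcases i with i | i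
    · exact (norm_eq_zero.2 (sub_self (Pi.single i 1))).trans_lt one_pos
    · exact (norm_le_pi_norm (Z - ω • 1) i).trans_lt (mem_unitPolydisc.1 hZ)
  have hli := hω.linearIndependent_of_norm_sub_lt hnear
  have hZ := isSiegelMatrixOf_siegelBasis Z
  exact ⟨_, siegelBasis Z, hZ.isLattice hli, ⟨linearIndependent_zInf hli, rfl⟩, hZ⟩

end IsQuadraticGenerator

end Lattice

/-! ### The lattice of `M(0)` -/

namespace Motive

variable {n : ℕ}

theorem norm_zero_le_one : ‖(0 : Matrix (Fin n) (Fin n) (CInf F))‖ ≤ 1 :=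
  norm_zero.trans_le zero_le_one

theorem expCoeff_zero_mulVec_pow {ζ : Fin n → CInf F} (hζ : ζ ^ q ^ 2 = ζ) (k : ℕ) :
    expCoeff 0 k *ᵥ ζ ^ q ^ k = expCoeff (0 : Matrix (Fin 1) (Fin 1) (CInf F)) k 0 0 • ζ := by
  induction k using Nat.twoStepInduction with
  | zero => simp [expCoeff]
  | one => simp [expCoeff]
  | more k ih _ =>
    have h : (expCoeff 0 k).map (CInf.frob 2) *ᵥ ζ ^ q ^ (k + 2)
        = expCoeff (0 : Matrix (Fin 1) (Fin 1) (CInf F)) k 0 0 ^ q ^ 2 • ζ := by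
      rw [pow_add q, pow_mul, ← mulVec_pow_card_pow, ih, smul_pow, hζ]
    simp only [expCoeff, zero_mul, zero_add, Matrix.smul_mulVec, h, Matrix.smul_apply,
      Matrix.map_apply, CInf.frob_apply, smul_smul, smul_eq_mul]

theorem tAct_zero_smul (l : CInf F) {ζ : Fin n → CInf F} (hζ : ζ ^ q ^ 2 = ζ) :
    tAct 0 (l • ζ) = (CInf.theta F * l + l ^ q ^ 2) • ζ := by
  rw [tAct_apply, Matrix.zero_mulVec, add_zero, smul_pow, hζ, smul_smul, add_smul]

theorem pow_card_sq_eq {l : CInf F} (hl : l ^ (q ^ 2 - 1) = -CInf.theta F) :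
    l ^ q ^ 2 = -(CInf.theta F * l) := by
  rw [← Nat.sub_one_add_one (card_pow_ne_zero (F := F) 2), pow_succ, hl, neg_mul]

theorem ne_zero_of_pow_eq_neg_theta {l : CInf F} (hl : l ^ (q ^ 2 - 1) = -CInf.theta F) :
    l ≠ 0 := by
  rintro rfl
  rw [zero_pow card_sq_sub_one_ne_zero, zero_eq_neg] at hl
  exact CInf.theta_ne_zero hl

theorem exists_eq_smul_of_tAct_zero_eq_zero {l : CInf F} (hl : l ^ (q ^ 2 - 1) = -CInf.theta F)
    {x : Fin n → CInf F} (hx : tAct 0 x = 0) : ∃ ζ : Fin n → CInf F, ζ ^ q ^ 2 = ζ ∧ x = l • ζ := by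
  have hl0 := ne_zero_of_pow_eq_neg_theta hl
  refine ⟨l⁻¹ • x, ?_, (smul_inv_smul₀ hl0 x).symm⟩
  rw [tAct_apply, Matrix.zero_mulVec, add_zero, add_comm, add_eq_zero_iff_eq_neg] at hx
  rw [smul_pow, hx, inv_pow, pow_card_sq_eq hl, ← neg_smul, smul_smul, inv_neg, neg_mul_neg,
    mul_inv_rev, inv_mul_cancel_right₀ CInf.theta_ne_zero]

/-- The number `l` is a coordinate of `T`-torsion points of `E(M(0))`, and `w` is its logarithm. -/
theorem exists_expMap_zero_smul_eq : ∃ w l : CInf F, ‖w‖ = torsionRadius F ∧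
    l ^ (q ^ 2 - 1) = -CInf.theta F ∧
    ∀ {n : ℕ} {ζ : Fin n → CInf F}, ζ ^ q ^ 2 = ζ → expMap 0 (w • ζ) = l • ζ := by
  obtain ⟨l, hl⟩ := CInf.exists_pow_eq_neg_theta (F := F)
  have hnl : ‖l‖ = torsionRadius F := by
    rw [← pow_left_inj₀ (norm_nonneg l) torsionRadius_pos.le (card_sq_sub_one_ne_zero (F := F)),
      ← norm_pow, hl, norm_neg, CInf.norm_theta, torsionRadius_pow]
  have hconst (c : CInf F) : ‖(fun _ => c : Fin 1 → CInf F)‖ = ‖c‖ := pi_norm_const c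
  obtain ⟨z, hz, hnz⟩ := exists_expMap_eq (norm_zero_le_one (F := F) (n := 1))
    (x := fun _ => l) (by rw [hconst, hnl]; exact torsionRadius_lt_periodRadius)
  obtain ⟨w, rfl⟩ : ∃ w, z = fun _ => w := ⟨z 0, funext fun i => by rw [Subsingleton.elim i 0]⟩
  refine ⟨w, l, by rw [← hnl, ← hconst, hnz, hconst], hl, fun {n ζ} hζ => ?_⟩
  have hsum := Pi.hasSum.1 (hasSum_expMap (norm_zero_le_one (F := F) (n := 1)) fun _ => w) 0
  rw [hz] at hsum
  refine (hasSum_expMap norm_zero_le_one (w • ζ)).unique ?_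
  convert hsum.smul_const ζ using 2 with k
  rw [seriesTerm_smul, seriesTerm, expCoeff_zero_mulVec_pow hζ, smul_smul, mul_comm]
  simp only [seriesTerm, Matrix.mulVec, dotProduct, Fin.sum_univ_one, Pi.pow_apply]

theorem eq_of_expMap_eq {A : Matrix (Fin n) (Fin n) (CInf F)} (hA : ‖A‖ ≤ 1)
    {z w : Fin n → CInf F} (h : expMap A z = expMap A w) (hzw : ‖z - w‖ < periodRadius F) :
    z = w := by
  by_contra hne
  refine (periodRadius_le_norm hA ?_ (sub_ne_zero.2 hne)).not_gt hzw
  rw [expMap_sub hA, h, sub_self]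

theorem pi_norm_le_one_of_pow_eq_self {ζ : Fin n → CInf F} (hζ : ζ ^ q ^ 2 = ζ) : ‖ζ‖ ≤ 1 := by
  by_contra! h
  have hlt := lt_self_pow₀ h (Nat.one_lt_pow two_ne_zero (Fintype.one_lt_card (α := F)))
  rw [← pi_norm_pow ζ (card_pow_ne_zero 2), hζ] at hlt
  exact lt_irrefl _ hlt

variable (F n) in
theorem exists_shortPeriods_zero_eq : ∃ y : CInf F, ‖y‖ = periodRadius F ∧
    {u | u ∈ expKer norm_zero_le_one ∧ ‖u‖ ≤ periodRadius F}
      = (y • ·) '' {ζ : Fin n → CInf F | ζ ^ q ^ 2 = ζ} := by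
  obtain ⟨w, l, hw, hl, hexp⟩ := exists_expMap_zero_smul_eq (F := F)
  have hwζ {ζ : Fin n → CInf F} (hζ : ζ ^ q ^ 2 = ζ) : ‖w • ζ‖ ≤ torsionRadius F := by
    rw [norm_smul, hw]
    exact mul_le_of_le_one_right torsionRadius_pos.le (pi_norm_le_one_of_pow_eq_self hζ)
  have hθ (z : Fin n → CInf F) :
      ‖CInf.theta F • z‖ ≤ periodRadius F ↔ ‖z‖ ≤ torsionRadius F := by
    rw [norm_theta_smul, periodRadius, mul_le_mul_iff_right₀ card_pos]
  refine ⟨CInf.theta F * w, by rw [norm_mul, CInf.norm_theta, hw, periodRadius],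
    Set.ext fun u => ⟨?_, ?_⟩⟩
  · rintro ⟨hu, hun⟩
    obtain ⟨z, rfl⟩ : ∃ z, CInf.theta F • z = u := ⟨_, smul_inv_smul₀ CInf.theta_ne_zero u⟩
    rw [hθ] at hun
    rw [mem_expKer, expMap_theta_smul norm_zero_le_one] at hu
    obtain ⟨ζ, hζ, hz⟩ := exists_eq_smul_of_tAct_zero_eq_zero hl hu
    have hwz : w • ζ = z := eq_of_expMap_eq norm_zero_le_one ((hexp hζ).trans hz.symm)
      ((norm_sub_le_of_norm_le (hwζ hζ) hun).trans_lt torsionRadius_lt_periodRadius)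
    exact ⟨ζ, hζ, by simp only [mul_smul, hwz]⟩
  · rintro ⟨ζ, hζ, rfl⟩
    simp only [mul_smul, Set.mem_ofPred_eq, hθ]
    refine ⟨?_, hwζ hζ⟩
    rw [mem_expKer, expMap_theta_smul norm_zero_le_one, hexp hζ, tAct_zero_smul l hζ,
      pow_card_sq_eq hl, add_neg_cancel, zero_smul]

end Motive

namespace IsQuadraticGenerator

variable {n : ℕ} {ω : CInf F}

theorem omegaBasis_pow_card_sq (hω : IsQuadraticGenerator ω) (i : Fin n ⊕ Fin n) :
    omegaBasis n ω i ^ q ^ 2 = omegaBasis n ω i := by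
  have hinl (i : Fin n) : omegaBasis n ω (Sum.inl i) ^ q ^ 2 = omegaBasis n ω (Sum.inl i) := by
    ext j
    simp [omegaBasis, siegelBasis, Pi.single_apply, ite_pow]
  rcases i with i | i
  · exact hinl i
  · rw [omegaBasis_inr, smul_pow, hω.pow_card_sq, hinl]

theorem mem_span_omegaBasis (hω : IsQuadraticGenerator ω) {ζ : Fin n → CInf F}
    (hζ : ζ ^ q ^ 2 = ζ) : ζ ∈ Submodule.span (ZInf F) (Set.range (omegaBasis n ω)) := by
  choose a b hab using fun i => hω.exists_eq_add_mul (congrFun hζ i)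
  rw [Submodule.mem_span_range_iff_exists_fun]
  refine ⟨Sum.elim (fun i => algebraMap F (ZInf F) (a i)) fun i => algebraMap F (ZInf F) (b i), ?_⟩
  simp only [Subalgebra.smul_def, sum_smul_omegaBasis]
  exact funext fun i => (hab i).symm

end IsQuadraticGenerator

namespace Motive

variable {n : ℕ} {ω y : CInf F}

theorem isNormalization_iff (hy : y ≠ 0) : IsNormalization n ω y ↔ expKer norm_zero_le_one
    = Submodule.span (ZInf F) (Set.range fun i => y • omegaBasis n ω i) := by
  rw [IsNormalization, siegelLattice, scaledMotiveLattice_eq_span_iff hy,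
    motiveLattice_eq_expKer norm_zero_le_one, SetLike.coe_set_eq, and_iff_right hy]

theorem exists_isNormalization (n : ℕ) (hω : IsQuadraticGenerator ω) :
    ∃ y : CInf F, ‖y‖ = periodRadius F ∧ IsNormalization n ω y := by
  obtain ⟨y, hny, hy⟩ := exists_shortPeriods_zero_eq F n
  have hy0 : y ≠ 0 := norm_pos_iff.1 (hny ▸ periodRadius_pos)
  refine ⟨y, hny, (isNormalization_iff hy0).2 (le_antisymm (expKer_le _ fun v hv hvn => ?_)
    (Submodule.span_le.2 ?_))⟩
  · obtain ⟨ζ, hζ, rfl⟩ := hy.subset ⟨hv, hvn⟩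
    have hmem := Set.mem_image_of_mem (LinearEquiv.smulOfNeZero (CInf F) (Fin n → CInf F) y hy0)
      (hω.mem_span_omegaBasis hζ)
    rwa [← span_zInf_range_eq_image] at hmem
  · rintro _ ⟨i, rfl⟩
    exact (hy.superset ⟨_, hω.omegaBasis_pow_card_sq i, rfl⟩).1

theorem norm_eq_periodRadius [Nonempty (Fin n)] (hω : IsQuadraticGenerator ω)
    (hy : IsNormalization n ω y) : ‖y‖ = periodRadius F := by
  obtain ⟨y₀, hny₀, hy₀⟩ := exists_isNormalization n hω
  obtain ⟨i⟩ := ‹Nonempty (Fin n)›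
  let v : Fin n → CInf F := Pi.single i 1
  have hv : ‖v‖ = 1 := by rw [Pi.norm_single, norm_one]
  have hv0 : v ≠ 0 := norm_ne_zero_iff.1 (hv ▸ one_ne_zero)
  have hvL : v ∈ siegelLattice (ω • (1 : Matrix (Fin n) (Fin n) (CInf F))) :=
    Submodule.subset_span ⟨Sum.inl i, rfl⟩
  have hker {c : CInf F} {u : Fin n → CInf F} (hc : IsNormalization n ω c) :
      expMap 0 (c • u) = 0 ↔ u ∈ siegelLattice (ω • (1 : Matrix (Fin n) (Fin n) (CInf F))) := by
    rw [← hc.2, ← mem_motiveLattice norm_zero_le_one]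
    rfl
  refine le_antisymm ?_ ?_
  · have hmem : y⁻¹ • y₀ • v ∈ siegelLattice (ω • (1 : Matrix (Fin n) (Fin n) (CInf F))) := by
      rw [← hker hy, smul_inv_smul₀ hy.1, hker hy₀]
      exact hvL
    have h := periodRadius_le_norm norm_zero_le_one ((hker hy₀).2 hmem)
      (smul_ne_zero hy₀.1 (smul_ne_zero (inv_ne_zero hy.1) (smul_ne_zero hy₀.1 hv0)))
    rwa [norm_smul, norm_smul, norm_smul, norm_inv, hv, mul_one, hny₀,
      le_mul_iff_one_le_right periodRadius_pos, inv_mul_eq_div,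
      one_le_div (norm_pos_iff.2 hy.1)] at h
  · have h := periodRadius_le_norm norm_zero_le_one ((hker hy).2 hvL) (smul_ne_zero hy.1 hv0)
    rwa [norm_smul, hv, mul_one] at h

theorem isNormOrthogonal_smul_omegaBasis (hω : IsQuadraticGenerator ω)
    (hy : IsNormalization n ω y) :
    IsNormOrthogonal (RInf F) (periodRadius F) fun i => y • omegaBasis n ω i := by
  rcases isEmpty_or_nonempty (Fin n) with hn | hn
  · intro a
    simp [Subsingleton.elim a 0]
  · have h := (hω.isNormOrthogonal_omegaBasis (n := n)).smul y
    rwa [norm_eq_periodRadius hω hy, mul_one] at h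

end Motive

/-! ### Deforming the lattice -/

namespace Motive

variable {n : ℕ} {A B : Matrix (Fin n) (Fin n) (CInf F)}

theorem exists_mem_expKer_near (hA : ‖A‖ ≤ 1) (hB : ‖B‖ ≤ 1) (hAB : ‖A - B‖ < 1)
    {u : Fin n → CInf F} (hu : u ∈ expKer hA) (hun : ‖u‖ ≤ periodRadius F) :
    ∃ v ∈ expKer hB, ‖v - u‖ ≤ ‖A - B‖ * periodRadius F := by
  have hsmall : ‖expMap B u‖ ≤ ‖A - B‖ * periodRadius F := by
    rw [← norm_neg, ← zero_sub, ← mem_expKer.1 hu]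
    exact (norm_expMap_sub_expMap_le hA hB hun).trans (by gcongr)
  obtain ⟨w, hw, hwn⟩ := exists_expMap_eq hB
    (hsmall.trans_lt (mul_lt_of_lt_one_left periodRadius_pos hAB))
  refine ⟨u - w, ?_, ?_⟩
  · rw [mem_expKer, expMap_sub hB, hw, sub_self]
  · rwa [sub_sub_cancel_left, norm_neg, hwn]

/-- A short period of `M(A)` is close to a short period `∑ gᵢ cᵢ` of `M(B)`, hence to `∑ gᵢ dᵢ`;
being periods of `M(A)` they coincide. -/
theorem expKer_eq_span_of_near (hA : ‖A‖ ≤ 1) (hB : ‖B‖ ≤ 1) (hAB : ‖A - B‖ < 1)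
    {ι : Type*} [Fintype ι] {c d : ι → Fin n → CInf F}
    (hc : IsNormOrthogonal (RInf F) (periodRadius F) c)
    (hspan : expKer hB = Submodule.span (ZInf F) (Set.range c)) (hd : ∀ i, d i ∈ expKer hA)
    (hdc : ∀ i, ‖d i - c i‖ < periodRadius F) :
    expKer hA = Submodule.span (ZInf F) (Set.range d) := by
  refine le_antisymm (expKer_le hA fun u hu hun => ?_) (Submodule.span_le.2 ?_)
  swap
  · rintro _ ⟨i, rfl⟩
    exact hd i
  obtain ⟨v, hv, hvu⟩ := exists_mem_expKer_near hA hB hAB hu hun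
  replace hvu : ‖v - u‖ < periodRadius F :=
    hvu.trans_lt (mul_lt_of_lt_one_left periodRadius_pos hAB)
  rw [hspan, Submodule.mem_span_range_iff_exists_fun] at hv
  obtain ⟨g, rfl⟩ := hv
  rw [Submodule.mem_span_range_iff_exists_fun]
  refine ⟨g, eq_of_expMap_eq hA ?_ ?_⟩
  · rw [mem_expKer.1 hu]
    exact mem_expKer.1 (sum_mem fun i _ => Submodule.smul_mem _ _ (hd i))
  choose a _ hsmul using fun i => exists_rInf_smul_eq (n := n) (g i)
  simp only [hsmul] at hvu ⊢
  have han : ‖a‖ ≤ 1 := by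
    have h := norm_add_le_of_norm_le hvu.le hun
    rwa [sub_add_cancel, hc, mul_le_iff_le_one_right periodRadius_pos] at h
  have hdv : ‖∑ i, a i • d i - ∑ i, a i • c i‖ < periodRadius F := by
    rw [← Finset.sum_sub_distrib]
    simp only [← smul_sub]
    calc ‖∑ i, a i • (d i - c i)‖
      _ ≤ ‖a‖ * ‖d - c‖ := norm_sum_smul_le a (d - c)
      _ ≤ ‖d - c‖ := mul_le_of_le_one_left (norm_nonneg _) han
      _ < periodRadius F := (pi_norm_lt_iff periodRadius_pos).2 hdc
  rw [← sub_add_sub_cancel]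
  exact (IsUltrametricDist.norm_add_le_max _ _).trans_lt (max_lt hdv hvu)

variable {ω y : CInf F}

theorem eq_of_mem_scaledMotiveLattice (hω : IsQuadraticGenerator ω) (hy : IsNormalization n ω y)
    (hA : ‖A‖ ≤ 1) {v w : Fin n → CInf F} (hv : v ∈ scaledMotiveLattice y A)
    (hw : w ∈ scaledMotiveLattice y A) (hvw : ‖v - w‖ < 1) : v = w := by
  rcases isEmpty_or_nonempty (Fin n) with hn | hn
  · exact Subsingleton.elim v w
  refine smul_right_injective _ hy.1 (eq_of_expMap_eq hA ?_ ?_)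
  · exact ((mem_motiveLattice hA).1 hv).trans ((mem_motiveLattice hA).1 hw).symm
  · rw [← smul_sub, norm_smul, norm_eq_periodRadius hω hy]
    exact mul_lt_of_lt_one_right periodRadius_pos hvw

theorem exists_span_eq_scaledMotiveLattice (hω : IsQuadraticGenerator ω)
    (hy : IsNormalization n ω y) (hA : A ∈ unitPolydisc 0) :
    ∃ l : Fin n ⊕ Fin n → Fin n → CInf F, (∀ i, ‖l i - omegaBasis n ω i‖ ≤ ‖A‖) ∧
      scaledMotiveLattice y A = Submodule.span (ZInf F) (Set.range l) := by
  have hA1 := norm_lt_one_of_mem_unitPolydisc hA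
  have h0A : ‖0 - A‖ < 1 := by rwa [zero_sub, norm_neg]
  have hspan := (isNormalization_iff hy.1).1 hy
  have horth := isNormOrthogonal_smul_omegaBasis hω hy
  choose d hd hdn using fun i => exists_mem_expKer_near norm_zero_le_one hA1.le h0A
    (hspan ▸ Submodule.subset_span ⟨i, rfl⟩) (horth.norm_apply i).le
  have hdlt (i) : ‖d i - y • omegaBasis n ω i‖ < periodRadius F :=
    (hdn i).trans_lt (mul_lt_of_lt_one_left periodRadius_pos h0A)
  have hA0 : ‖A - 0‖ < 1 := by rwa [sub_zero]
  have hker := expKer_eq_span_of_near hA1.le norm_zero_le_one hA0 horth hspan hd hdlt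
  have hyd (i) : y • y⁻¹ • d i = d i := smul_inv_smul₀ hy.1 (d i)
  refine ⟨fun i => y⁻¹ • d i, fun i => ?_, (scaledMotiveLattice_eq_span_iff hy.1).2 ?_⟩
  · have : Nonempty (Fin n) := ⟨i.elim id id⟩
    have hyn := norm_eq_periodRadius hω hy
    have h := hdn i
    rwa [← hyd i, ← smul_sub, norm_smul, hyn, zero_sub, norm_neg, mul_comm,
      mul_le_mul_iff_left₀ periodRadius_pos] at h
  · simp only [hyd]
    rw [motiveLattice_eq_expKer hA1.le, hker]

end Motive

namespace IsSiegelMatrixOf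

variable {n : ℕ} {b : Fin n ⊕ Fin n → Fin n → CInf F} {A Z : Matrix (Fin n) (Fin n) (CInf F)}
  {ω y : CInf F}

theorem motiveLattice_isLattice_and_latticeEquiv (h : IsSiegelMatrixOf b Z)
    (hω : IsQuadraticGenerator ω) (hb : ∀ i, ‖b i - omegaBasis n ω i‖ < 1) (hy : y ≠ 0)
    (hspan : scaledMotiveLattice y A = Submodule.span (ZInf F) (Set.range b)) :
    IsLattice (2 * n) (motiveLattice A) ∧ LatticeEquiv (motiveLattice A) (siegelLattice Z) := by
  have horth := (hω.isNormOrthogonal_omegaBasis.of_norm_sub_lt hb).smul y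
  rw [(scaledMotiveLattice_eq_span_iff hy).1 hspan]
  exact ⟨(h.smul hy).isLattice (horth.linearIndependent (by simpa using hy)),
    (h.smul hy).latticeEquiv⟩

end IsSiegelMatrixOf

theorem tendsto_of_forall_norm_sub_le {n : ℕ} {E : Type*} [SeminormedAddCommGroup E]
    {U : Set (Matrix (Fin n) (Fin n) (CInf F))} (h₀ : 0 ∈ U) {f : U → E} {x : E}
    (hf : ∀ A, ‖f A - x‖ ≤ ‖A.1‖) : Tendsto f (𝓝 ⟨0, h₀⟩) (𝓝 x) := by
  refine tendsto_iff_norm_sub_tendsto_zero.2 (squeeze_zero (fun _ => norm_nonneg _) hf ?_)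
  have h := (continuous_subtype_val (p := (· ∈ U))).norm.tendsto ⟨0, h₀⟩
  rwa [norm_zero] at h

end

theorem proposition2p2 {F : Type*} [Field F] [Fintype F] (n : ℕ) (ω : CInf F)
    (hω : ω ^ (Fintype.card F ^ 2) = ω) (hω' : ω ^ Fintype.card F ≠ ω) :
    (∀ A : Matrix (Fin n) (Fin n) (CInf F), IsTMotive F n (2 * n) (Motive A)) ∧
    (∃ y : CInf F, IsNormalization n ω y) ∧
    ∀ y : CInf F, IsNormalization n ω y →
      ∃ (U₁ U₃ : Set (Matrix (Fin n) (Fin n) (CInf F))) (h₁ : 0 ∈ U₁) (μ₁₃ : U₁ → U₃),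
        IsOpen U₁ ∧ IsOpen U₃ ∧
        ω • (1 : Matrix (Fin n) (Fin n) (CInf F)) ∈ U₃ ∧ U₃ ⊆ siegelMatrices F n ∧
        (∀ A : U₁, IsLattice (2 * n) (motiveLattice A.1) ∧
          LatticeEquiv (motiveLattice A.1) (siegelLattice (μ₁₃ A).1)) ∧
        ∃ l : U₁ → Fin n ⊕ Fin n → Fin n → CInf F,
          (∀ A : U₁, IsZBasis (l A) (scaledMotiveLattice y A.1) ∧
            IsSiegelMatrixOf (l A) (μ₁₃ A).1) ∧
          (∃ ρ : ℝ, 0 < ρ ∧ ∀ (A : U₁) (i : Fin n ⊕ Fin n),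
            ‖l A i - siegelBasis (ω • 1) i‖ < ρ ∧
            ∀ v ∈ scaledMotiveLattice y A.1,
              ‖v - siegelBasis (ω • 1) i‖ < ρ → v = l A i) ∧
          ∀ i, Tendsto (fun A => l A i) (𝓝 (⟨0, h₁⟩ : U₁)) (𝓝 (siegelBasis (ω • 1) i)) := by
  have hgen : IsQuadraticGenerator ω := ⟨hω, hω'⟩
  refine ⟨Motive.isTMotive, (Motive.exists_isNormalization n hgen).imp fun _ => And.right,
    fun y hy => ?_⟩
  choose l hl hspan using fun A : unitPolydisc 0 =>
    Motive.exists_span_eq_scaledMotiveLattice hgen hy A.2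
  have hl1 (A i) : ‖l A i - omegaBasis n ω i‖ < 1 :=
    (hl A i).trans_lt (norm_lt_one_of_mem_unitPolydisc A.2)
  choose Z hZ using fun A => hgen.exists_isSiegelMatrixOf (hl1 A)
  refine ⟨unitPolydisc 0, unitPolydisc (ω • 1), self_mem_unitPolydisc 0, Z, isOpen_unitPolydisc 0,
    isOpen_unitPolydisc _, self_mem_unitPolydisc _, hgen.unitPolydisc_subset_siegelMatrices,
    fun A => (hZ A).motiveLattice_isLattice_and_latticeEquiv hgen (hl1 A) hy.1 (hspan A),
    l, fun A => ⟨⟨?_, (hspan A).symm⟩, hZ A⟩,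
    ⟨1, one_pos, fun A i => ⟨hl1 A i, fun v hv hvi => ?_⟩⟩,
    fun i => tendsto_of_forall_norm_sub_le _ fun A => hl A i⟩
  · exact linearIndependent_zInf (hgen.linearIndependent_of_norm_sub_lt (hl1 A))
  · have hA1 := norm_lt_one_of_mem_unitPolydisc A.2
    refine Motive.eq_of_mem_scaledMotiveLattice hgen hy hA1.le hv ?_ ?_
    · exact hspan A ▸ Submodule.subset_span ⟨i, rfl⟩
    · rw [← sub_add_sub_cancel v (omegaBasis n ω i)]
      exact (IsUltrametricDist.norm_add_le_max _ _).trans_lt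
        (max_lt hvi ((norm_sub_rev _ _).trans_lt (hl1 A i)))
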